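/- **Notation.** Let $\mathfrak H$ be a complex Hilbert space and $A$ a closed linear operator in $\mathfrak H$, not necessarily densely defined, which is symmetric: $(Ax,y)=(x,Ay)$ for $x,y\in\operatorname{dom}A$. Put $\mathfrak H_0=\overline{\operatorname{dom}}\,A$ and let $A^*$, an operator from $\mathfrak H$ to $\mathfrak H_0$, be the adjoint of $A:\mathfrak H_0\to\mathfrak H$. Let $\mathfrak H_+=\operatorname{dom}A^*$ with the inner product $(f,g)_+=(f,g)+(A^*f,A^*g)$, and let $\mathfrak H_-$ be the dual space of the continuous (antilinear) functionals on $\mathfrak H_+$, so that $\mathfrak H_+\subset\mathfrak H\subset\mathfrak H_-$. Here $[\mathfrak H_1,\mathfrak H_2]$ denotes the bounded operators from $\mathfrak H_1$ to $\mathfrak H_2$, and adjoints of elements of $[\mathfrak H_+,\mathfrak H_-]$ are again in $[\mathfrak H_+,\mathfrak H_-]$. * $\Omega_A$ is the class of closed densely defined operators $T$ in $\mathfrak H$ such that $A=T\cap T^*$ (intersection of graphs) and $-i$ is a regular point of $T$. * $\mathbb B\in[\mathfrak H_+,\mathfrak H_-]$ is a *self-adjoint bi-extension* of $A$ if $\mathbb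 B\supset A$, $\mathbb B=\mathbb B^*$, and the operator $\{\{x,\mathbb Bx\}:x\in\mathfrak H_+,\ \mathbb Bx\in\mathfrak H\}$ is a self-adjoint extension of $A$ in $\mathfrak H$. * $\mathbb A\in[\mathfrak H_+,\mathfrak H_-]$ is a *correct $(*)$-extension* of $T\in\Omega_A$ if $T\subset\mathbb A$, $T^*\subset\mathbb A^*$ and $\mathbb A_R=\frac12(\mathbb A+\mathbb A^*)$ is a self-adjoint bi-extension of $A$. * For $\mathbb B\in[\mathfrak H_+,\mathfrak H_-]$, an operator $F_+$ and $K\in[\mathfrak E,\mathfrak H_-]$, let $\rho(\mathbb B,F_+,K)$ be the set of all $z\in\mathbb C$ for which $(\mathbb B-zF_+)^{-1}$ exists on $\mathfrak H\cup\operatorname{ran}K$ and is $(-,\cdot)$-continuous, i.e. continuous from the norm of $\mathfrak H_-$ to the norm of $\mathfrak H$, on the linear span of this set. An *$F_+$-system* with finite-dimensional input-output Hilbert space $\mathfrak E$ consists of a Hilbert space $\mathfrak H$, a closed symmetric operator $A$ in it, and $\mathbb A,F_+,K,J$ such that 1. $\mathbb A\in[\mathfrak H_+,\mathfrak H_-]$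 is a correct $(*)$-extension of some $T\in\Omega_A$; 2. $J=J^*=J^{-1}:\mathfrak E\to\mathfrak E$; 3. $\mathbb A-\mathbb A^*=2iKJK^*$, where $K\in[\mathfrak E,\mathfrak H_-]$ and $\ker K=\{0\}$; 4. $F_+$ is an orthogonal projection both in $\mathfrak H_+$ and in $\mathfrak H$; 5. $\rho(\mathbb A,F_+,K)$ is open; 6. $\rho(\mathbb A_R,F_+,K)$ and $\rho(\mathbb A,F_+,K)\cap\rho(\mathbb A_R,F_+,K)$ are open; 7. $z\in\rho(\mathbb A,F_+,K)$ implies $\bar z\in\rho(\mathbb A^*,F_+,K)$, and $z\in\rho(\mathbb A_R,F_+,K)$ implies $\bar z\in\rho(\mathbb A_R,F_+,K)$. It is a *scattering system* if $J=I$. Its transfer function is $W_\Theta(z)=I-2iK^*(\mathbb A-zF_+)^{-1}KJ$, $z\in\rho(\mathbb A,F_+,K)$. **Theorem 4.1.** Let $V(z)$ be a Herglotz–Nevanlinna function acting on a finite-dimensional complex Hilbert space $\mathfrak E$, that is, $V$ is holomorphic on $\mathbb C\setminus\mathbb R$, $V(z)^*=V(\bar z)$, and $\operatorname{Im}V(z)\ge0$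 for $\operatorname{Im}z>0$. Assume that $V$ has an integral representation without linear term $$V(z)=Q+\int_{\mathbb R}\Bigl(\frac1{t-z}-\frac t{1+t^2}\Bigr)\,d\Sigma(t),\qquad z\in\mathbb C\setminus\mathbb R,$$ where $Q=Q^*$ and $\Sigma$ is a nondecreasing operator-valued function on $\mathbb R$ with $\int_{\mathbb R}\frac{(d\Sigma(t)x,x)}{1+t^2}<\infty$ for all $x\in\mathfrak E$. Then there is a scattering $F_+$-system $\Theta$ with input-output space $\mathfrak E$ such that the open lower half-plane is contained in $\rho(\mathbb A,F_+,K)$ and, for every non-real $z\in\rho(\mathbb A,F_+,K)$, the operator $W_\Theta(z)+I$ is invertible and $$V(z)=i\,[W_\Theta(z)+I]^{-1}[W_\Theta(z)-I].$$ -/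

import Mathlib

open Complex MeasureTheory
open scoped ComplexConjugate

universe u

noncomputable section

namespace FPlus

/-! ### Herglotz-Nevanlinna functions and their integral representation -/

section Herglotz

variable {E : Type*} [NormedAddCommGroup E] [InnerProductSpace ℂ E]

/-- Herglotz-Nevanlinna functions with values in the operators on `E`: holomorphic off the real
axis, symmetric (the adjoint of `V z` is `V` at the conjugate point), with nonnegative imaginary
part in the upper half-plane. Mathlib's inner product is linear in its second argument. -/
structure IsHerglotzNevanlinna (V : ℂ → E →L[ℂ] E) : Prop where
  holomorphic : DifferentiableOn ℂ V {z : ℂ | z.im ≠ 0}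
  symm : ∀ z : ℂ, z.im ≠ 0 → ∀ x y : E, inner ℂ (V z x) y = inner ℂ x (V (conj z) y)
  im_nonneg : ∀ z : ℂ, 0 < z.im → ∀ x : E, 0 ≤ (inner ℂ x (V z x)).im

/-- The scalar distribution function `t ↦ (S(t) x, x)` of a nondecreasing operator function. -/
theorem monotone_form {S : ℝ → E →L[ℂ] E} (hS : Monotone S) (x : E) :
    Monotone fun t => (inner ℂ x (S t x)).re := by
  intro s t hst
  have h := (hS hst).re_inner_nonneg_right x
  simp only [sub_apply, inner_sub_right, map_sub, sub_nonneg] at h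
  exact h

/-- The Lebesgue-Stieltjes measure `(dS(t) x, x)` of a nondecreasing (in the Loewner order)
operator function `S`. -/
def formMeasure (S : ℝ → E →L[ℂ] E) (hS : Monotone S) (x : E) : Measure ℝ :=
  (monotone_form hS x).stieltjesFunction.measure

/-- `∫ (dS(t) x, x) / (1 + t²) < ∞` for all `x`. -/
def HasFiniteNevanlinnaIntegral (S : ℝ → E →L[ℂ] E) (hS : Monotone S) : Prop :=
  ∀ x : E, Integrable (fun t : ℝ => 1 / (1 + t ^ 2)) (formMeasure S hS x)

/-- The representation `V(z) = Q + ∫ (1/(t-z) - t/(1+t²)) dS(t)`, `z ∈ ℂ \ ℝ`, without a linear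
term. The operator-valued integral is given by its quadratic form (which determines an operator
on a complex space). -/
def HasIntegralRepresentation (V : ℂ → E →L[ℂ] E) (Q : E →L[ℂ] E)
    (S : ℝ → E →L[ℂ] E) (hS : Monotone S) : Prop :=
  ∀ z : ℂ, z.im ≠ 0 → ∀ x : E,
    inner ℂ x (V z x) = inner ℂ x (Q x) +
      ∫ t : ℝ, (1 / ((t : ℂ) - z) - (t : ℂ) / (1 + (t : ℂ) ^ 2)) ∂(formMeasure S hS x)

end Herglotz

/-! ### The rigged Hilbert space of a (not necessarily densely defined) symmetric operator -/

section Rigged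

variable {H : Type*} [NormedAddCommGroup H] [InnerProductSpace ℂ H] [CompleteSpace H]

/-- The closure of the domain of `A`. -/
abbrev domClosure (A : H →ₗ.[ℂ] H) : Submodule ℂ H := A.domain.topologicalClosure

/-- `A`, regarded as a densely defined operator from the closure of its domain into `H`. -/
def fromClosure (A : H →ₗ.[ℂ] H) : domClosure A →ₗ.[ℂ] H where
  domain := A.domain.comap (domClosure A).subtype
  toFun := A.toFun ∘ₗ
    ((domClosure A).subtype.restrict (p := A.domain.comap (domClosure A).subtype)
      (q := A.domain) fun _ hx => hx)

/-- The adjoint of `A : domClosure A → H`, an operator from `H` into `domClosure A`. -/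
abbrev adj (A : H →ₗ.[ℂ] H) : H →ₗ.[ℂ] domClosure A := (fromClosure A).adjoint

/-- The graph of the adjoint, in the Hilbert direct sum `H ⊕ domClosure A`. -/
def plusSubmodule (A : H →ₗ.[ℂ] H) : Submodule ℂ (WithLp 2 (H × domClosure A)) :=
  (adj A).graph.comap (WithLp.linearEquiv 2 ℂ (H × domClosure A)).toLinearMap

/-- `H₊`: the domain of `A*` with the graph inner product `(f, g) + (A* f, A* g)`, realized as the
graph of `A*` inside the Hilbert direct sum. -/
abbrev Plus (A : H →ₗ.[ℂ] H) : Type _ := plusSubmodule A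

/-- The inclusion of `H₊` into `H`. -/
def incl (A : H →ₗ.[ℂ] H) : Plus A →L[ℂ] H :=
  (WithLp.fstL 2 ℂ H (domClosure A)).comp (plusSubmodule A).subtypeL

/-- `H₋`: the continuous antilinear functionals on `H₊`, with the dual norm; `φ f` is the
pairing `(φ, f)` of `φ ∈ H₋` with `f ∈ H₊`. -/
abbrev Minus (A : H →ₗ.[ℂ] H) : Type _ := Plus A →L⋆[ℂ] ℂ

/-- The inclusion of `H` into `H₋`: the vector `h` is the functional `f ↦ (h, f)`. -/
def embed (A : H →ₗ.[ℂ] H) : H →ₗ[ℂ] Minus A where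
  toFun h := ((innerSL ℂ).flip h).comp (incl A)
  map_add' h k := by ext f; simp
  map_smul' c h := by ext f; simp

theorem embed_apply (A : H →ₗ.[ℂ] H) (h : H) (f : Plus A) :
    embed A h f = inner ℂ (incl A f) h := rfl

/-- The adjoint of `B ∈ [H₊, H₋]`, again an element of `[H₊, H₋]`. -/
def bAdj {A : H →ₗ.[ℂ] H} (B : Plus A →L[ℂ] Minus A) : Plus A →L[ℂ] Minus A :=
  (ContinuousLinearMap.compSL (Plus A) ℂ ℂ (RingHom.id ℂ) (starRingEnd ℂ)
    ((starL ℂ : ℂ ≃L⋆[ℂ] ℂ) : ℂ →L⋆[ℂ] ℂ)).comp B.flip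

theorem bAdj_apply {A : H →ₗ.[ℂ] H} (B : Plus A →L[ℂ] Minus A) (f g : Plus A) :
    bAdj B f g = conj (B g f) := rfl

/-- The real part `(B + B*)/2` of `B ∈ [H₊, H₋]`. -/
def rePart {A : H →ₗ.[ℂ] H} (B : Plus A →L[ℂ] Minus A) : Plus A →L[ℂ] Minus A :=
  (1 / 2 : ℂ) • (B + bAdj B)

/-- The inclusion `S ⊂ B` for an operator `S` in `H` and `B ∈ [H₊, H₋]`. -/
def Extends {A : H →ₗ.[ℂ] H} (B : Plus A →L[ℂ] Minus A) (S : H →ₗ.[ℂ] H) : Prop :=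
  ∀ x : S.domain, ∃ f : Plus A, incl A f = x ∧ B f = embed A (S x)

/-- `λ` is a regular point of `T`: the inverse of `T - λ` exists on all of `H` and is bounded. -/
def IsRegularPoint (T : H →ₗ.[ℂ] H) (l : ℂ) : Prop :=
  Function.Bijective (fun x : T.domain => T x - l • (x : H)) ∧
    ∃ C : ℝ, ∀ x : T.domain, ‖(x : H)‖ ≤ C * ‖T x - l • (x : H)‖

/-- The class `Ω_A`: closed densely defined `T` with `A = T ∩ T*` (intersection of graphs) for
which `-i` is a regular point. -/
structure OmegaClass (A T : H →ₗ.[ℂ] H) : Prop where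
  closed : T.IsClosed
  dense : Dense (T.domain : Set H)
  inter : A.graph = T.graph ⊓ T.adjoint.graph
  regular : IsRegularPoint T (-I)

/-- `B` is a bi-extension of `A`. -/
def IsBiExtension {A : H →ₗ.[ℂ] H} (B : Plus A →L[ℂ] Minus A) : Prop :=
  Extends B A ∧ Extends (bAdj B) A

/-- The set of pairs `{x, B x}` with `x ∈ H₊` and `B x ∈ H`. -/
def inducedGraph {A : H →ₗ.[ℂ] H} (B : Plus A →L[ℂ] Minus A) : Set (H × H) :=
  {p | ∃ f : Plus A, incl A f = p.1 ∧ B f = embed A p.2}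

/-- `B` is a self-adjoint bi-extension of `A`: a bi-extension with `B = B*` such that the operator
with graph `{x, B x}`, `x ∈ H₊`, `B x ∈ H`, is a self-adjoint extension of `A` in `H`. -/
structure IsSelfAdjointBiExtension {A : H →ₗ.[ℂ] H} (B : Plus A →L[ℂ] Minus A) : Prop where
  biExtension : IsBiExtension B
  symm : bAdj B = B
  induced : ∃ S : H →ₗ.[ℂ] H, (S.graph : Set (H × H)) = inducedGraph B ∧ A ≤ S ∧ IsSelfAdjoint S

/-- `B` is a correct `(*)`-extension of `T`: `T ⊂ B`, `T* ⊂ B*`, and the real part of `B` is a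
self-adjoint bi-extension of `A`. -/
structure IsCorrectStarExtension {A : H →ₗ.[ℂ] H} (T : H →ₗ.[ℂ] H)
    (B : Plus A →L[ℂ] Minus A) : Prop where
  ext : Extends B T
  ext_adj : Extends (bAdj B) T.adjoint
  correct : IsSelfAdjointBiExtension (rePart B)

/-- `F` is an orthogonal projection in `H` which restricts to an orthogonal projection in `H₊`
(with respect to the inner product of `H₊`). -/
def IsOrthProjInBoth (A : H →ₗ.[ℂ] H) (F : H →L[ℂ] H) : Prop :=
  (F : H →ₗ[ℂ] H).IsSymmetricProjection ∧
    ∃ G : Plus A →ₗ[ℂ] Plus A, LinearMap.IsSymmetricProjection (𝕜 := ℂ) (E := Plus A) G ∧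
      ∀ f, incl A (G f) = F (incl A f)

/-- The pencil `B - z F ∈ [H₊, H₋]`, as a linear map. -/
def pencil {A : H →ₗ.[ℂ] H} (B : Plus A →L[ℂ] Minus A) (F : H →L[ℂ] H) (z : ℂ) :
    Plus A →ₗ[ℂ] Minus A :=
  (B : Plus A →ₗ[ℂ] Minus A) -
    z • (embed A ∘ₗ (F : H →ₗ[ℂ] H) ∘ₗ (incl A : Plus A →ₗ[ℂ] H))

variable {E : Type*} [NormedAddCommGroup E] [InnerProductSpace ℂ E]

/-- The set `ρ(B, F, K)` of all `z` for which the inverse of `B - z F` exists on `H ∪ ran K` (the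
pencil is injective and its range contains `H` and `ran K`) and is `(-,·)`-continuous, i.e. bounded
from the norm of `H₋` to the norm of `H` on the linear span of `H ∪ ran K`. -/
def rho {A : H →ₗ.[ℂ] H} (B : Plus A →L[ℂ] Minus A) (F : H →L[ℂ] H) (K : E →L[ℂ] Minus A) :
    Set ℂ :=
  {z | Function.Injective (pencil B F z) ∧
    (∀ h : H, embed A h ∈ LinearMap.range (pencil B F z)) ∧
    (∀ e : E, K e ∈ LinearMap.range (pencil B F z)) ∧
    ∃ C : ℝ, ∀ f : Plus A,
      pencil B F z f ∈ LinearMap.range (embed A) ⊔ LinearMap.range (K : E →ₗ[ℂ] Minus A) →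
        ‖incl A f‖ ≤ C * ‖pencil B F z f‖}

variable [FiniteDimensional ℂ E]

/-- The adjoint `K* ∈ [H₊, E]` of `K ∈ [E, H₋]`. -/
def kAdj {A : H →ₗ.[ℂ] H} (K : E →L[ℂ] Minus A) : Plus A →L[ℂ] E :=
  haveI : CompleteSpace E := FiniteDimensional.complete ℂ E
  ((InnerProductSpace.toDual ℂ E).symm.toContinuousLinearEquiv :
    StrongDual ℂ E →L⋆[ℂ] E).comp K.flip

theorem inner_kAdj {A : H →ₗ.[ℂ] H} (K : E →L[ℂ] Minus A) (f : Plus A) (e : E) :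
    inner ℂ (kAdj K f) e = K e f := by
  have : CompleteSpace E := FiniteDimensional.complete ℂ E
  exact InnerProductSpace.toDual_symm_apply (x := e) (y := K.flip f)

open Classical in
/-- `(B - z F)⁻¹ K : E → H₊` for `z ∈ ρ(B, F, K)` (and `0` for other `z`). -/
def resolventK {A : H →ₗ.[ℂ] H} (B : Plus A →L[ℂ] Minus A) (F : H →L[ℂ] H)
    (K : E →L[ℂ] Minus A) (z : ℂ) : E →ₗ[ℂ] Plus A :=
  if h : z ∈ rho B F K then
    LinearMap.codRestrictOfInjective (K : E →ₗ[ℂ] Minus A) (pencil B F z) h.1 h.2.2.1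
  else 0

end Rigged

/-! ### `F₊`-systems -/

/-- An `F₊`-system (`F₊`-colligation) with state space `H` and finite-dimensional input-output
space `E`. -/
structure FPlusSystem (H E : Type*) [NormedAddCommGroup H] [InnerProductSpace ℂ H]
    [CompleteSpace H] [NormedAddCommGroup E] [InnerProductSpace ℂ E] [FiniteDimensional ℂ E] where
  /-- the closed symmetric operator which defines the rigged Hilbert space -/
  A : H →ₗ.[ℂ] H
  A_closed : A.IsClosed
  A_symm : A.IsFormalAdjoint A
  /-- the operator of which the main operator is a correct `(*)`-extension -/
  T : H →ₗ.[ℂ] H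
  T_mem : OmegaClass A T
  /-- the main operator -/
  B : Plus A →L[ℂ] Minus A
  B_correct : IsCorrectStarExtension T B
  J : E →L[ℂ] E
  J_symm : (J : E →ₗ[ℂ] E).IsSymmetric
  J_sq : J * J = 1
  K : E →L[ℂ] Minus A
  K_inj : Function.Injective K
  im_eq : B - bAdj B = (2 * I) • (K.comp (J.comp (kAdj K)))
  F : H →L[ℂ] H
  F_proj : IsOrthProjInBoth A F
  rho_open : IsOpen (rho B F K)
  rho_re_open : IsOpen (rho (rePart B) F K)
  rho_inter_open : IsOpen (rho B F K ∩ rho (rePart B) F K)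
  rho_conj : ∀ z ∈ rho B F K, conj z ∈ rho (bAdj B) F K
  rho_re_conj : ∀ z ∈ rho (rePart B) F K, conj z ∈ rho (rePart B) F K

namespace FPlusSystem

variable {H E : Type*} [NormedAddCommGroup H] [InnerProductSpace ℂ H]
    [CompleteSpace H] [NormedAddCommGroup E] [InnerProductSpace ℂ E] [FiniteDimensional ℂ E]

/-- A scattering system: `J = I`. -/
def IsScattering (Θ : FPlusSystem H E) : Prop := Θ.J = 1

/-- The set `ρ` of the system, on which its transfer function is defined. -/
def resolventSet (Θ : FPlusSystem H E) : Set ℂ := rho Θ.B Θ.F Θ.K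

/-- The transfer function `W(z) = I - 2i K* (B - z F)⁻¹ K J`. -/
def transfer (Θ : FPlusSystem H E) (z : ℂ) : E →L[ℂ] E :=
  1 - (2 * I) • LinearMap.toContinuousLinearMap
    ((kAdj Θ.K : Plus Θ.A →ₗ[ℂ] E) ∘ₗ resolventK Θ.B Θ.F Θ.K z ∘ₗ (Θ.J : E →ₗ[ℂ] E))

end FPlusSystem

end FPlus

end

noncomputable section

set_option linter.unusedSectionVars false

namespace FPlus

/-! Let `L` be the maximal operator and `Γ₀`, `Γ₁` boundary maps into `E` linked to it by Green's
identity. With `K = Γ₁*` and `B θ = A* + K (Γ₀ + θ Γ₁)`, Green's identity gives `(B θ)* = B (conj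
θ)`, so `B I` has real part `B 0` and imaginary part `K K*`: the scattering relation. In `H₋` the
decomposition of a vector as `h + K e` is unique, hence `(B I - z F) f = K e` means `L f = z F f`
together with `Γ₀ f + i Γ₁ f = e`, and then `W e = e - 2i Γ₁ f = Γ₀ f - i Γ₁ f`. If `Γ₁ f = V(z) Γ₀
f` on all solutions of `L f = z F f`, this says `W = (1 - iV)(1 + iV)⁻¹`, which inverts to the
asserted formula (`transfer_spec`). The other axioms come from Green's identity (adjoints,
uniqueness), from dissipativity with a dimension count (`solvable_mul_I`), and from uniform
boundedness (`Solvable.mem_rho`).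

It remains to find a boundary system with this relation. The measures `(dΣ x, x) / (1 + t²)` have
bounded densities with respect to one finite measure `μ` (`exists_density`); the square root of
multiplication by the operator density gives `Γ : E → L²(μ; E)` with `V(z) = Q + Γ* ((1 + zt)/(t -
z)) Γ` (`exists_factorization`, `exists_operator_representation`). Let `R` be the resolvent at `i`
of multiplication by `t`. The vectors `f = R p + Γ e` with images `m = p + i f` and `Γ₀ = e` are the
natural maximal operator, and `m = z f` yields `Γ₁ = V(z) Γ₀`.

Two defects prevent its direct use. A nonzero `p` in `X = R⁻¹(ran Γ)` can occur with `f = 0`, and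
`Γ₁` misses the directions in `N = ker Γ`. Auxiliary spaces repair both. The `X`-part of `f` enters
the state as `b φ + κ P_X f`, where `ran b` meets `ran κ` only in zero, so that `φ` and `P_X f` are
both recovered; a further component `b ψ` accompanies it, with `ψ` coupled to `P_X m`. The maximal
operator sends these two components to `ψ` and `φ`, and this exchange cancels the `b`-terms in
Green's identity. A component `b' η + κ' P_N e` adds `P_N κ'* η` to `Γ₁` and makes it onto. Since
`F` annihilates the components `b ψ` and `b' η + κ' P_N e`, the equation `L v = z F v` forces `φ = η
= 0` and then `m = z f`, so the additions leave `V` unchanged. -/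

/-- An abstract boundary system: `(ι p, L p)` parametrizes the graph of the adjoint of a symmetric
operator in `H`, and `Γ₀`, `Γ₁` are boundary maps for it; `F` is a projection for which the pencil
`L - z F` with boundary condition `Γ₀` is solvable for all non-real `z`. -/
structure BoundarySystem (P H E : Type*) [AddCommGroup P] [Module ℂ P]
    [NormedAddCommGroup H] [InnerProductSpace ℂ H]
    [NormedAddCommGroup E] [InnerProductSpace ℂ E] where
  ι : P →ₗ[ℂ] H
  L : P →ₗ[ℂ] H
  Γ₀ : P →ₗ[ℂ] E
  Γ₁ : P →ₗ[ℂ] E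
  F : H →L[ℂ] H
  F' : H →L[ℂ] H
  ι_inj : Function.Injective ι
  green : ∀ p q, inner ℂ (ι p) (L q) - inner ℂ (L p) (ι q) =
    inner ℂ (Γ₀ p) (Γ₁ q) - inner ℂ (Γ₁ p) (Γ₀ q)
  F_proj : (F : H →ₗ[ℂ] H).IsSymmetricProjection
  F'_symm : (F' : H →ₗ[ℂ] H).IsSymmetric
  solv : ∀ z : ℂ, z.im ≠ 0 → ∀ h e, ∃ p, L p - z • F (ι p) = h ∧ Γ₀ p = e
  surj : ∀ y, ∃ p, Γ₀ p = 0 ∧ Γ₁ p = y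
  reduces : ∀ p, ∃ q, ι q = F (ι p) ∧ L q = F' (L p)

/-! ### Green's identity and solvability of the boundary problems. -/

namespace BoundarySystem

section Algebra

variable {P H E : Type*} [AddCommGroup P] [Module ℂ P]
    [NormedAddCommGroup H] [InnerProductSpace ℂ H]
    [NormedAddCommGroup E] [InnerProductSpace ℂ E] (D : BoundarySystem P H E)

theorem F_symm (x y : H) : inner ℂ (D.F x) y = inner ℂ x (D.F y) :=
  D.F_proj.isSymmetric x y

theorem F_F (x : H) : D.F (D.F x) = D.F x :=
  DFunLike.congr_fun D.F_proj.isIdempotentElem x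

theorem inner_F_self (x : H) : inner ℂ x (D.F x) = (‖D.F x‖ : ℂ) ^ 2 := by
  rw [← D.F_F x, ← D.F_symm, D.F_F, inner_self_eq_norm_sq_to_K]; rfl

/-- The combined boundary map `Γ₀ + θ Γ₁`. -/
def bdry (θ : ℂ) : P →ₗ[ℂ] E := D.Γ₀ + θ • D.Γ₁

theorem bdry_apply (θ : ℂ) (p : P) : D.bdry θ p = D.Γ₀ p + θ • D.Γ₁ p := rfl

theorem bdry_zero : D.bdry 0 = D.Γ₀ := by simp [bdry]

/-- The boundary problem for `L - z F` and `Γ₀ + θ Γ₁` is solvable. -/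
def Solvable (θ z : ℂ) : Prop := ∀ h e, ∃ p, D.L p - z • D.F (D.ι p) = h ∧ D.bdry θ p = e

/-- The terms `θ (Γ₁ q, Γ₁ p)` and `z (F ι q, ι p)` cancel in Green's identity, so conjugating both
`θ` and `z` produces the adjoint boundary problem. Uniqueness, adjoints and the bounds on resolvents
are all read off from this form. -/
theorem green_bdry (θ z : ℂ) (p q : P) :
    inner ℂ (D.ι q) (D.L p - z • D.F (D.ι p)) + inner ℂ (D.Γ₁ q) (D.bdry θ p) =
      inner ℂ (D.L q - conj z • D.F (D.ι q)) (D.ι p) + inner ℂ (D.bdry (conj θ) q) (D.Γ₁ p) := by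
  have h := D.green q p
  simp only [bdry_apply, inner_sub_right, inner_sub_left, inner_add_right, inner_add_left,
    inner_smul_left, inner_smul_right, conj_conj, D.F_symm]
  linear_combination h

theorem solvable_zero {z : ℂ} (hz : z.im ≠ 0) : D.Solvable 0 z := by
  intro h e
  simpa [bdry_zero] using D.solv z hz h e

variable {D}

/-- Solving the adjoint problem with right-hand side `ι p` turns Green's identity into `‖ι p‖² = 0`.
-/
theorem Solvable.unique {θ z : ℂ} (h : D.Solvable (conj θ) (conj z)) {p : P}
    (h₁ : D.L p - z • D.F (D.ι p) = 0) (h₂ : D.bdry θ p = 0) : p = 0 := by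
  apply D.ι_inj
  rw [map_zero]
  obtain ⟨q, hq₁, hq₂⟩ := h (D.ι p) 0
  have := D.green_bdry θ z p q
  rw [h₁, h₂, hq₁, hq₂] at this
  simpa using this.symm

/-- The operator with boundary condition `Γ₀ + θ Γ₁ = 0` has as its adjoint the one with
`Γ₀ + conj θ Γ₁ = 0`. -/
theorem Solvable.exists_of_adjoint {θ z : ℂ} (h : D.Solvable θ z)
    (h' : D.Solvable (conj θ) (conj z)) {y w : H}
    (hyw : ∀ p, D.bdry θ p = 0 → inner ℂ y (D.L p) = inner ℂ w (D.ι p)) :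
    ∃ q, D.bdry (conj θ) q = 0 ∧ D.ι q = y ∧ D.L q = w := by
  obtain ⟨q, hq, hq0⟩ := h' (w - conj z • D.F y) 0
  have key : D.ι q = y := by
    rw [← sub_eq_zero, ← inner_self_eq_zero (𝕜 := ℂ)]
    -- The defect `ι q - y` is orthogonal to the range of the pencil on `Γ₀ + θ Γ₁ = 0`, which is
    -- everything; testing against the defect itself kills it.
    obtain ⟨p, hp, hp0⟩ := h (D.ι q - y) 0
    have h1 := D.green_bdry θ z p q
    rw [hq, hp0, hq0] at h1
    have h2 := hyw p hp0
    nth_rewrite 2 [← hp]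
    rw [inner_sub_left]
    simp only [inner_zero_left, inner_zero_right, add_zero] at h1
    rw [h1]
    simp only [inner_sub_right, inner_sub_left, inner_smul_left, inner_smul_right, conj_conj,
      D.F_symm, h2]
    ring
  refine ⟨q, hq0, key, ?_⟩
  rw [key] at hq
  exact sub_left_injective hq

variable (D)

theorem inner_L_self (p : P) : (inner ℂ (D.ι p) (D.L p)).im = (inner ℂ (D.Γ₀ p) (D.Γ₁ p)).im := by
  have h := congrArg Complex.im (D.green p p)
  rw [← inner_conj_symm (D.L p), ← inner_conj_symm (D.Γ₁ p)] at h
  simp only [sub_im, conj_im] at h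
  linarith

/-- Dissipativity: the imaginary part of the form of `L` under `Γ₀ + i c Γ₁ = 0`, `c` real. -/
theorem im_inner_L_of_bdry (c : ℝ) {p : P} (hp : D.bdry (c * I) p = 0) :
    (inner ℂ (D.ι p) (D.L p)).im = c * ‖D.Γ₁ p‖ ^ 2 := by
  rw [D.inner_L_self]
  have : D.Γ₀ p = -((c * I : ℂ) • D.Γ₁ p) := by
    rw [bdry_apply] at hp; exact eq_neg_of_add_eq_zero_left hp
  rw [this, inner_neg_left, inner_smul_left, inner_self_eq_norm_sq_to_K]
  have h2 : ((‖D.Γ₁ p‖ : ℂ) ^ 2) = ((‖D.Γ₁ p‖ ^ 2 : ℝ) : ℂ) := by push_cast; rfl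
  simp only [coe_algebraMap, h2]
  simp only [map_mul, conj_ofReal, conj_I, neg_im, mul_im, mul_re, ofReal_re, ofReal_im, neg_re,
    I_re, I_im]
  ring

theorem eq_zero_of_L_eq_zero {p : P} (h₀ : D.Γ₀ p = 0) (hL : D.L p = 0) (hF : D.F (D.ι p) = 0) :
    p = 0 := by
  have h : D.Solvable (conj 0) (conj I) := by
    simpa using D.solvable_zero (z := -I) (by simp)
  apply h.unique
  · rw [hL, hF]; simp
  · rw [bdry_zero, h₀]

theorem im_smul_of_pencil {z : ℂ} {p : P} (h : D.L p - z • D.F (D.ι p) = 0) :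
    (inner ℂ (D.ι p) (D.L p)).im = z.im * ‖D.F (D.ι p)‖ ^ 2 := by
  rw [sub_eq_zero.1 h, inner_smul_right, D.inner_F_self]
  have h2 : ((‖D.F (D.ι p)‖ : ℂ) ^ 2) = ((‖D.F (D.ι p)‖ ^ 2 : ℝ) : ℂ) := by push_cast; rfl
  rw [h2, im_mul_ofReal]

/-- The imaginary part of `(ι p, L p)` equals both `Im z ‖F ι p‖²` and `c ‖Γ₁ p‖²`. Opposite signs
make both vanish, which leaves a vector with all boundary data and `L p` zero. -/
theorem pencil_injective (c : ℝ) {z : ℂ} (hc : c * z.im < 0) {p : P}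
    (h : D.L p - z • D.F (D.ι p) = 0) (hb : D.bdry (c * I) p = 0) : p = 0 := by
  have h1 := (D.im_smul_of_pencil h).symm.trans (D.im_inner_L_of_bdry c hb)
  have h2 : c * z.im * ‖D.F (D.ι p)‖ ^ 2 = c ^ 2 * ‖D.Γ₁ p‖ ^ 2 := by
    linear_combination c * h1
  have hc0 : c ≠ 0 := by rintro rfl; simp at hc
  have h3 : 0 ≤ c ^ 2 * ‖D.Γ₁ p‖ ^ 2 := by positivity
  have h4 : ‖D.F (D.ι p)‖ ^ 2 = 0 := by
    by_contra hne
    have : 0 < ‖D.F (D.ι p)‖ ^ 2 := lt_of_le_of_ne (by positivity) (Ne.symm hne)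
    nlinarith
  have hF : D.F (D.ι p) = 0 := by simpa using h4
  have h5 : ‖D.Γ₁ p‖ ^ 2 = 0 := by
    rw [h4, mul_zero] at h2
    have := h2.symm
    simpa [hc0] using this
  have hΓ : D.Γ₁ p = 0 := by simpa using h5
  refine D.eq_zero_of_L_eq_zero ?_ ?_ hF
  · rw [bdry_apply, hΓ] at hb; simpa using hb
  · rw [hF] at h; simpa using h

/-- The solutions of the homogeneous pencil equation are parametrized by `Γ₀` and hence form a copy
of `E`. On it `Γ₀ + i c Γ₁` is injective by dissipativity, so it is surjective by dimension; adding
such a solution corrects the boundary value of a particular one. -/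
theorem solvable_mul_I [FiniteDimensional ℂ E] (c : ℝ) {z : ℂ} (hc : c * z.im < 0) :
    D.Solvable (c * I) z := by
  have hz : z.im ≠ 0 := by intro h; simp [h] at hc
  set N : Submodule ℂ P := LinearMap.ker (D.L - z • (D.F : H →ₗ[ℂ] H) ∘ₗ D.ι) with hN
  have memN : ∀ p, p ∈ N ↔ D.L p - z • D.F (D.ι p) = 0 := fun p => by simp [hN]
  set f : N →ₗ[ℂ] E := D.Γ₀ ∘ₗ N.subtype with hf
  have hz' : D.Solvable (conj 0) (conj z) := by
    simpa using D.solvable_zero (z := conj z) (by simpa using hz)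
  have finj : Function.Injective f := by
    rw [← LinearMap.ker_eq_bot, LinearMap.ker_eq_bot']
    rintro ⟨p, hp⟩ h
    refine Subtype.ext (hz'.unique ((memN p).1 hp) ?_)
    rw [bdry_zero]; exact h
  have fsurj : Function.Surjective f := by
    intro e
    obtain ⟨p, hp, hpe⟩ := D.solv z hz 0 e
    exact ⟨⟨p, (memN p).2 hp⟩, hpe⟩
  set eq := LinearEquiv.ofBijective f ⟨finj, fsurj⟩
  set g : E →ₗ[ℂ] E := D.bdry (c * I) ∘ₗ N.subtype ∘ₗ eq.symm.toLinearMap with hg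
  have ginj : Function.Injective g := by
    rw [← LinearMap.ker_eq_bot, LinearMap.ker_eq_bot']
    intro e he
    have h0 := D.pencil_injective c hc ((memN _).1 (eq.symm e).2) he
    simpa using h0
  have gsurj := LinearMap.injective_iff_surjective.1 ginj
  intro h e
  obtain ⟨p, hp, -⟩ := D.solv z hz h 0
  obtain ⟨e', he'⟩ := gsurj (e - D.bdry (c * I) p)
  refine ⟨p + (eq.symm e' : N), ?_, ?_⟩
  · have := (memN _).1 (eq.symm e').2
    rw [map_add, map_add, map_add, smul_add, add_sub_add_comm, hp, this, add_zero]
  · rw [map_add]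
    have : D.bdry (c * I) (eq.symm e' : N) = e - D.bdry (c * I) p := he'
    rw [this]; abel

end Algebra

end BoundarySystem

/-! ### The operators in `H`: density, adjoints and the class `Ω_A`. -/

namespace BoundarySystem

section Operators

variable {P H E : Type*} [AddCommGroup P] [Module ℂ P]
    [NormedAddCommGroup H] [InnerProductSpace ℂ H]
    [NormedAddCommGroup E] [InnerProductSpace ℂ E] (D : BoundarySystem P H E)

/-- The operator `ι p ↦ L p` on the image of a subspace `W`. -/
def op (W : Submodule ℂ P) : H →ₗ.[ℂ] H := (W.map (D.ι.prod D.L)).toLinearPMap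

theorem graph_op (W : Submodule ℂ P) : (D.op W).graph = W.map (D.ι.prod D.L) := by
  rw [op, Submodule.toLinearPMap_graph_eq]
  rintro ⟨x, y⟩ ⟨p, -, hp⟩ h0
  have h1 : D.ι p = x := congrArg Prod.fst hp
  have h2 : D.L p = y := congrArg Prod.snd hp
  have : p = 0 := D.ι_inj (by rw [h1, map_zero]; exact h0)
  rw [← h2, this, map_zero]

theorem mem_graph_op {W : Submodule ℂ P} {x : H × H} :
    x ∈ (D.op W).graph ↔ ∃ p ∈ W, D.ι p = x.1 ∧ D.L p = x.2 := by
  rw [graph_op]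
  constructor
  · rintro ⟨p, hp, rfl⟩
    exact ⟨p, hp, rfl, rfl⟩
  · rintro ⟨p, hp, h1, h2⟩
    exact ⟨p, hp, Prod.ext h1 h2⟩

/-- The symmetric operator of the boundary system. -/
def A : H →ₗ.[ℂ] H := D.op (LinearMap.ker D.Γ₀ ⊓ LinearMap.ker D.Γ₁)

/-- The operator with boundary condition `Γ₀ + θ Γ₁ = 0`. -/
def T (θ : ℂ) : H →ₗ.[ℂ] H := D.op (LinearMap.ker (D.bdry θ))

theorem mem_graph_A {x : H × H} :
    x ∈ D.A.graph ↔ ∃ p, D.Γ₀ p = 0 ∧ D.Γ₁ p = 0 ∧ D.ι p = x.1 ∧ D.L p = x.2 := by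
  rw [A, mem_graph_op]
  simp [and_assoc]

theorem mem_graph_T {θ : ℂ} {x : H × H} :
    x ∈ (D.T θ).graph ↔ ∃ p, D.bdry θ p = 0 ∧ D.ι p = x.1 ∧ D.L p = x.2 := by
  rw [T, mem_graph_op]
  simp

theorem exists_of_mem_domain_A (x : D.A.domain) :
    ∃ p, D.Γ₀ p = 0 ∧ D.Γ₁ p = 0 ∧ D.ι p = x ∧ D.L p = D.A x :=
  D.mem_graph_A.1 (D.A.mem_graph x)

theorem exists_of_mem_domain_T {θ : ℂ} (x : (D.T θ).domain) :
    ∃ p, D.bdry θ p = 0 ∧ D.ι p = x ∧ D.L p = D.T θ x :=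
  D.mem_graph_T.1 ((D.T θ).mem_graph x)

theorem mem_domain_A {p : P} (h0 : D.Γ₀ p = 0) (h1 : D.Γ₁ p = 0) : D.ι p ∈ D.A.domain :=
  LinearPMap.mem_domain_iff.2 ⟨D.L p, D.mem_graph_A.2 ⟨p, h0, h1, rfl, rfl⟩⟩

theorem mem_domain_T {θ : ℂ} {p : P} (hp : D.bdry θ p = 0) : D.ι p ∈ (D.T θ).domain :=
  LinearPMap.mem_domain_iff.2 ⟨D.L p, D.mem_graph_T.2 ⟨p, hp, rfl, rfl⟩⟩

theorem T_apply {θ : ℂ} {p : P} (hp : D.bdry θ p = 0) :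
    D.T θ ⟨D.ι p, D.mem_domain_T hp⟩ = D.L p :=
  (D.T θ).mem_graph_snd_inj ((D.T θ).mem_graph ⟨D.ι p, D.mem_domain_T hp⟩)
    (D.mem_graph_T.2 ⟨p, hp, rfl, rfl⟩) rfl

/-- This identifies the graph of `A*`. After subtraction of a solution `u` of the pencil equation at
`-i`, the remainder `y - ι u` is orthogonal to `ran (A - iF)`. The orthogonal complement of the
homogeneous solutions lies in that range, and these solutions form a finite-dimensional, hence
closed, space, so the remainder is itself such a solution. -/
theorem exists_of_symm_adjoint [FiniteDimensional ℂ E] {y w : H}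
    (hyw : ∀ p, D.Γ₀ p = 0 → D.Γ₁ p = 0 → inner ℂ (D.L p) y = inner ℂ (D.ι p) w) :
    ∃ q, D.ι q = y ∧ D.L q = w := by
  have hgood : D.Solvable 0 (conj I) := D.solvable_zero (by simp)
  have hgood' : D.Solvable (conj 0) (conj I) := by simpa using hgood
  obtain ⟨u, hu, hu0⟩ := D.solvable_zero (z := conj I) (by simp) (w - conj I • D.F y) 0
  set N : Submodule ℂ P := LinearMap.ker (D.L - (conj I : ℂ) • (D.F : H →ₗ[ℂ] H) ∘ₗ D.ι) with hN
  have memN : ∀ p, p ∈ N ↔ D.L p - (conj I : ℂ) • D.F (D.ι p) = 0 := fun p => by simp [hN]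
  have h' : D.Solvable (conj 0) (conj (conj I)) := by
    simpa using D.solvable_zero (z := I) (by simp)
  have finj : Function.Injective (D.Γ₀ ∘ₗ N.subtype) := by
    rw [← LinearMap.ker_eq_bot, LinearMap.ker_eq_bot']
    rintro ⟨p, hp⟩ h
    refine Subtype.ext (h'.unique ((memN p).1 hp) ?_)
    rw [bdry_zero]; exact h
  have : FiniteDimensional ℂ N := FiniteDimensional.of_injective _ finj
  have hmem : y - D.ι u ∈ N.map D.ι := by
    rw [← Submodule.orthogonal_orthogonal (N.map D.ι), Submodule.mem_orthogonal]
    intro h hh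
    obtain ⟨x, hx, hx0⟩ := D.solvable_zero (z := I) (by simp) h 0
    rw [bdry_zero] at hx0 hu0
    have hx1 : D.Γ₁ x = 0 := by
      rw [← inner_self_eq_zero (𝕜 := ℂ)]
      -- A homogeneous solution with `Γ₀ q = Γ₁ x` makes Green's identity read `‖Γ₁ x‖² = 0`; thus
      -- `x` satisfies both boundary conditions of `A`.
      obtain ⟨q, hq, hq0⟩ := hgood 0 (D.Γ₁ x)
      have h1 := D.green_bdry 0 I x q
      rw [hq, hx] at h1
      rw [Submodule.mem_orthogonal] at hh
      rw [hh (D.ι q) ⟨q, (memN q).2 hq, rfl⟩] at h1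
      simp only [map_zero, bdry_zero, hx0, inner_zero_right, inner_zero_left, zero_add] at h1 hq0
      rw [hq0] at h1
      exact h1.symm
    have h2 := hyw x hx0 hx1
    have h3 := D.green x u
    rw [hx0, hx1, inner_zero_left, inner_zero_left, sub_zero, sub_eq_zero] at h3
    rw [← hx, inner_sub_left, inner_sub_right, inner_sub_right, h2, ← h3, ← inner_sub_right,
      ← inner_sub_right, inner_smul_left, D.F_symm]
    have h4 : w - D.L u = conj I • D.F (y - D.ι u) := by
      rw [sub_eq_iff_eq_add.1 hu, map_sub, smul_sub]; abel
    rw [h4, inner_smul_right, sub_self]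
  obtain ⟨q, hq, hqy⟩ := hmem
  have hq := (memN q).1 hq
  refine ⟨u + q, by rw [map_add, hqy]; abel, ?_⟩
  rw [map_add, sub_eq_zero.1 hq, hqy, sub_eq_iff_eq_add.1 hu, map_sub, smul_sub]
  abel

/-- A vector `w` orthogonal to the domain gives the pair `(0, w)` in the adjoint graph, and
injectivity of `ι` forces `w = 0`. -/
theorem dense_A [FiniteDimensional ℂ E] [CompleteSpace H] : Dense (D.A.domain : Set H) := by
  rw [Submodule.dense_iff_topologicalClosure_eq_top, Submodule.topologicalClosure_eq_top_iff,
    Submodule.eq_bot_iff]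
  intro w hw
  rw [Submodule.mem_orthogonal] at hw
  obtain ⟨q, hq, hq'⟩ := D.exists_of_symm_adjoint (y := 0) (w := w) (fun p h0 h1 => by
    rw [inner_zero_right, hw]
    exact D.mem_domain_A h0 h1)
  have : q = 0 := D.ι_inj (by rw [hq, map_zero])
  rw [← hq', this, map_zero]

theorem A_le_T (θ : ℂ) : D.A ≤ D.T θ := by
  apply LinearPMap.le_of_le_graph
  intro x hx
  obtain ⟨p, h0, h1, h⟩ := D.mem_graph_A.1 hx
  exact D.mem_graph_T.2 ⟨p, by simp [bdry_apply, h0, h1], h⟩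

theorem dense_T [FiniteDimensional ℂ E] [CompleteSpace H] (θ : ℂ) :
    Dense ((D.T θ).domain : Set H) :=
  D.dense_A.mono (D.A_le_T θ).1

variable {D}

theorem Solvable.adjoint_T [FiniteDimensional ℂ E] [CompleteSpace H] {θ z : ℂ}
    (h : D.Solvable θ z) (h' : D.Solvable (conj θ) (conj z)) :
    (D.T θ).adjoint = D.T (conj θ) := by
  apply LinearPMap.eq_of_eq_graph
  ext ⟨y, w⟩
  rw [LinearPMap.adjoint_graph_eq_graph_adjoint (D.dense_T θ), Submodule.mem_adjoint_iff,
    mem_graph_T]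
  constructor
  · intro hyw
    refine h.exists_of_adjoint h' fun p hp => ?_
    have := hyw _ _ (D.mem_graph_T.2 ⟨p, hp, rfl, rfl⟩)
    rw [sub_eq_zero] at this
    rw [← inner_conj_symm, this, inner_conj_symm]
  · rintro ⟨q, hq, rfl, rfl⟩ a b hab
    obtain ⟨p, hp, rfl, rfl⟩ := D.mem_graph_T.1 hab
    have h1 := D.green_bdry (conj θ) 0 q p
    simp only [hq, hp, conj_conj, map_zero, zero_smul, sub_zero, inner_zero_left, inner_zero_right,
      add_zero] at h1
    rw [h1, sub_self]

theorem Solvable.isClosed_T [FiniteDimensional ℂ E] [CompleteSpace H] {θ z : ℂ}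
    (h : D.Solvable θ z) (h' : D.Solvable (conj θ) (conj z)) : (D.T θ).IsClosed := by
  have := Solvable.adjoint_T (D := D) (θ := conj θ) (z := conj z) h' (by simpa using h)
  rw [conj_conj] at this
  rw [← this]
  exact LinearPMap.adjoint_isClosed (D.dense_T _)

variable (D)

theorem solvable_I [FiniteDimensional ℂ E] {z : ℂ} (hz : z.im < 0) : D.Solvable I z := by
  simpa using D.solvable_mul_I 1 (z := z) (by simpa using hz)

theorem solvable_neg_I [FiniteDimensional ℂ E] {z : ℂ} (hz : 0 < z.im) : D.Solvable (-I) z := by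
  simpa using D.solvable_mul_I (-1) (z := z) (by simpa using hz)

theorem A_symm : D.A.IsFormalAdjoint D.A := by
  intro x y
  obtain ⟨p, hp0, hp1, hp, hp'⟩ := D.exists_of_mem_domain_A x
  obtain ⟨q, hq0, hq1, hq, hq'⟩ := D.exists_of_mem_domain_A y
  have := D.green p q
  rw [hp0, hp1, inner_zero_left, inner_zero_left, sub_zero, hp, hp', hq, hq', sub_eq_zero] at this
  exact this.symm

/-- Under this boundary condition the imaginary part of `(ι p, L p + i ι p)` is `‖Γ₁ p‖² + ‖ι p‖²`.
-/
theorem norm_le_of_bdry_I {p : P} (hp : D.bdry I p = 0) : ‖D.ι p‖ ≤ ‖D.L p + I • D.ι p‖ := by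
  have h1 : (inner ℂ (D.ι p) (D.L p + I • D.ι p)).im ≥ ‖D.ι p‖ ^ 2 := by
    have h2 := D.im_inner_L_of_bdry 1 (p := p) (by simpa using hp)
    have h3 : ((‖D.ι p‖ : ℂ) ^ 2) = ((‖D.ι p‖ ^ 2 : ℝ) : ℂ) := by push_cast; rfl
    rw [inner_add_right, add_im, h2, inner_smul_right, inner_self_eq_norm_sq_to_K]
    simp only [coe_algebraMap, h3, I_mul_im, ofReal_re]
    have : 0 ≤ ‖D.Γ₁ p‖ ^ 2 := by positivity
    linarith
  have h4 := (Complex.abs_im_le_norm _).trans (norm_inner_le_norm (𝕜 := ℂ) (D.ι p)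
    (D.L p + I • D.ι p))
  have h5 := (le_abs_self _).trans h4
  rcases (norm_nonneg (D.ι p)).eq_or_lt with h | h
  · rw [← h]; positivity
  · nlinarith

variable [FiniteDimensional ℂ E] [CompleteSpace H]

theorem adjoint_T_zero : (D.T 0).adjoint = D.T 0 := by
  have := Solvable.adjoint_T (D := D) (θ := 0) (z := I) (D.solvable_zero (by simp))
    (by simpa using D.solvable_zero (z := -I) (by simp))
  simpa using this

theorem adjoint_T_I : (D.T I).adjoint = D.T (-I) := by
  have := Solvable.adjoint_T (D := D) (θ := I) (z := -I) (D.solvable_I (by simp))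
    (by simpa using D.solvable_neg_I (z := I) (by simp))
  simpa using this

theorem isClosed_T_I : (D.T I).IsClosed :=
  Solvable.isClosed_T (D := D) (θ := I) (z := -I) (D.solvable_I (by simp))
    (by simpa using D.solvable_neg_I (z := I) (by simp))

theorem graph_A : D.A.graph = (D.T I).graph ⊓ (D.T I).adjoint.graph := by
  rw [adjoint_T_I]
  ext x
  rw [Submodule.mem_inf, mem_graph_A, mem_graph_T, mem_graph_T]
  constructor
  · rintro ⟨p, h0, h1, h⟩
    exact ⟨⟨p, by simp [bdry_apply, h0, h1], h⟩, ⟨p, by simp [bdry_apply, h0, h1], h⟩⟩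
  · rintro ⟨⟨p, hp, h, h'⟩, ⟨q, hq, h2, -⟩⟩
    obtain rfl := D.ι_inj (h.trans h2.symm)
    rw [bdry_apply] at hp hq
    have h1 : D.Γ₁ p = 0 := by
      have : (2 * I) • D.Γ₁ p = 0 := by
        calc (2 * I) • D.Γ₁ p = (D.Γ₀ p + I • D.Γ₁ p) - (D.Γ₀ p + (-I) • D.Γ₁ p) := by module
          _ = 0 := by rw [hp, hq, sub_zero]
      simpa using this
    exact ⟨p, by simpa [h1] using hp, h1, h, h'⟩

theorem isClosed_A : D.A.IsClosed := by
  rw [LinearPMap.IsClosed, graph_A]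
  exact D.isClosed_T_I.inter (LinearPMap.adjoint_isClosed (D.dense_T _))

/-- Solvability of the pencil does not apply, since here the identity stands in place of `F`. The a
priori bound makes the range closed, and dissipativity of the adjoint operator makes its orthogonal
complement trivial. -/
theorem range_T_I (h : H) : ∃ p, D.bdry I p = 0 ∧ D.L p + I • D.ι p = h := by
  set W := (D.T I).graph
  have hW : IsClosed (W : Set (H × H)) := D.isClosed_T_I
  have : CompleteSpace W := hW.completeSpace_coe
  set f : W →L[ℂ] H := (ContinuousLinearMap.snd ℂ H H + I • ContinuousLinearMap.fst ℂ H H).comp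
    W.subtypeL with hf
  have hanti : AntilipschitzWith 2 f := by
    apply f.antilipschitz_of_bound
    rintro ⟨⟨x, y⟩, hx⟩
    obtain ⟨p, hp, rfl, rfl⟩ := D.mem_graph_T.1 hx
    have h1 := D.norm_le_of_bdry_I hp
    change max ‖D.ι p‖ ‖D.L p‖ ≤ 2 * ‖D.L p + I • D.ι p‖
    apply max_le
    · linarith [norm_nonneg (D.ι p)]
    · have : D.L p = (D.L p + I • D.ι p) - I • D.ι p := by abel
      have h2 := norm_sub_le (D.L p + I • D.ι p) (I • D.ι p)
      rw [← this, norm_smul, norm_I, one_mul] at h2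
      linarith
  have hcl : IsClosed (LinearMap.range (f : W →ₗ[ℂ] H) : Set H) :=
    hanti.isClosed_range f.uniformContinuous
  have hrange : LinearMap.range (f : W →ₗ[ℂ] H) = ⊤ := by
    rw [← hcl.submodule_topologicalClosure_eq, Submodule.topologicalClosure_eq_top_iff,
      Submodule.eq_bot_iff]
    intro y hy
    rw [Submodule.mem_orthogonal'] at hy
    obtain ⟨q, hq0, hq, hq'⟩ := Solvable.exists_of_adjoint (D := D) (θ := I) (z := -I)
      (D.solvable_I (by simp)) (by simpa using D.solvable_neg_I (z := I) (by simp))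
      -- Orthogonality of `y` to the range says `(y, L p) = (i y, ι p)`, so `y` is an eigenvector of
      -- the adjoint for `i`; there `‖y‖² = -‖Γ₁ q‖²`.
      (y := y) (w := I • y) (fun p hp => by
        have := hy _ ⟨⟨(D.ι p, D.L p), D.mem_graph_T.2 ⟨p, hp, rfl, rfl⟩⟩, rfl⟩
        change inner ℂ y (D.L p + I • D.ι p) = 0 at this
        rw [inner_add_right, inner_smul_right] at this
        rw [inner_smul_left, conj_I]
        linear_combination this)
    have h2 := D.im_inner_L_of_bdry (-1) (p := q) (by simpa using hq0)
    have h3 : ((‖y‖ : ℂ) ^ 2) = ((‖y‖ ^ 2 : ℝ) : ℂ) := by push_cast; rfl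
    rw [hq, hq', inner_smul_right, inner_self_eq_norm_sq_to_K] at h2
    simp only [coe_algebraMap, h3, I_mul_im, ofReal_re] at h2
    have h4 : ‖y‖ ^ 2 = 0 := by nlinarith [sq_nonneg ‖y‖, sq_nonneg ‖D.Γ₁ q‖]
    simpa using h4
  have hh : h ∈ LinearMap.range (f : W →ₗ[ℂ] H) := by rw [hrange]; trivial
  obtain ⟨⟨⟨x, y⟩, hx⟩, hxy⟩ := hh
  obtain ⟨p, hp, rfl, rfl⟩ := D.mem_graph_T.1 hx
  exact ⟨p, hp, hxy⟩

theorem omegaClass : OmegaClass D.A (D.T I) where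
  closed := D.isClosed_T_I
  dense := D.dense_T I
  inter := D.graph_A
  regular := by
    have key : ∀ x : (D.T I).domain, ‖(x : H)‖ ≤ ‖D.T I x - (-I) • (x : H)‖ := by
      intro x
      obtain ⟨p, hp, h1, h2⟩ := D.exists_of_mem_domain_T x
      rw [← h1, ← h2, neg_smul, sub_neg_eq_add]
      exact D.norm_le_of_bdry_I hp
    refine ⟨⟨?_, ?_⟩, 1, by simpa using key⟩
    · intro x y hxy
      have h := key (x - y)
      have : D.T I (x - y) - (-I) • ((x - y : (D.T I).domain) : H) = 0 := by
        rw [LinearPMap.map_sub, Submodule.coe_sub, smul_sub]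
        rw [← sub_eq_zero] at hxy
        rw [← hxy]; simp only; abel
      rw [this, norm_zero] at h
      have h0 : ((x - y : (D.T I).domain) : H) = 0 := norm_le_zero_iff.1 h
      exact sub_eq_zero.1 (Subtype.ext h0)
    · intro h
      obtain ⟨p, hp, hph⟩ := D.range_T_I h
      refine ⟨⟨D.ι p, D.mem_domain_T hp⟩, ?_⟩
      simp only
      rw [D.T_apply hp, neg_smul, sub_neg_eq_add, hph]

end Operators

end BoundarySystem

/-! ### The rigging `H₊ ⊂ H ⊂ H₋` and the correct `(*)`-extension. -/

namespace BoundarySystem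

section Rigging

variable {P H E : Type*} [AddCommGroup P] [Module ℂ P]
    [NormedAddCommGroup H] [InnerProductSpace ℂ H] [CompleteSpace H]
    [NormedAddCommGroup E] [InnerProductSpace ℂ E] [FiniteDimensional ℂ E]
    (D : BoundarySystem P H E)

theorem domClosure_eq_top : domClosure D.A = ⊤ :=
  (Submodule.dense_iff_topologicalClosure_eq_top).1 D.dense_A

theorem mem_graph_fromClosure {x : domClosure D.A × H} :
    x ∈ (fromClosure D.A).graph ↔ ((x.1 : H), x.2) ∈ D.A.graph := by
  obtain ⟨⟨a, ha⟩, b⟩ := x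
  rw [LinearPMap.mem_graph_iff, LinearPMap.mem_graph_iff]
  constructor
  · rintro ⟨y, hy, hy'⟩
    exact ⟨⟨(y : domClosure D.A), y.2⟩, congrArg Subtype.val hy, hy'⟩
  · rintro ⟨y, hy, hy'⟩
    dsimp only at hy
    subst hy
    exact ⟨⟨⟨y, ha⟩, y.2⟩, rfl, hy'⟩

theorem dense_fromClosure : Dense ((fromClosure D.A).domain : Set (domClosure D.A)) := by
  change Dense (Subtype.val ⁻¹' (D.A.domain : Set H))
  rw [Subtype.dense_iff]
  intro x hx
  have hsub : (D.A.domain : Set H) ⊆ Subtype.val '' (Subtype.val ⁻¹' (D.A.domain : Set H) :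
      Set (domClosure D.A)) :=
    fun y hy => ⟨⟨y, D.A.domain.le_topologicalClosure hy⟩, hy, rfl⟩
  exact closure_mono hsub hx

theorem mem_graph_adj {x : H × domClosure D.A} :
    x ∈ (adj D.A).graph ↔ ∃ p, D.ι p = x.1 ∧ D.L p = x.2 := by
  rw [adj, LinearPMap.adjoint_graph_eq_graph_adjoint D.dense_fromClosure, Submodule.mem_adjoint_iff]
  constructor
  · intro h
    apply D.exists_of_symm_adjoint
    intro p h0 h1
    have hp : D.ι p ∈ domClosure D.A := D.A.domain.le_topologicalClosure (D.mem_domain_A h0 h1)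
    have := h ⟨D.ι p, hp⟩ (D.L p) (D.mem_graph_fromClosure.2
      (D.mem_graph_A.2 ⟨p, h0, h1, rfl, rfl⟩))
    exact sub_eq_zero.1 this
  · rintro ⟨q, hq, hq'⟩ a b hab
    obtain ⟨p, h0, h1, hp, hp'⟩ := D.mem_graph_A.1 (D.mem_graph_fromClosure.1 hab)
    have := D.green p q
    rw [h0, h1, inner_zero_left, inner_zero_left, sub_zero, sub_eq_zero, hq, hq', hp, hp'] at this
    rw [sub_eq_zero]
    exact this.symm

theorem mem_plusSubmodule {x : WithLp 2 (H × domClosure D.A)} :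
    x ∈ plusSubmodule D.A ↔ ∃ p, D.ι p = x.fst ∧ D.L p = x.snd :=
  D.mem_graph_adj (x := (x.fst, x.snd))

/-- The parametrization of `H₊` by the boundary system. -/
def ofParam : P →ₗ[ℂ] Plus D.A where
  toFun p := ⟨WithLp.toLp 2 (D.ι p, ⟨D.L p, by rw [D.domClosure_eq_top]; trivial⟩),
    D.mem_plusSubmodule.2 ⟨p, rfl, rfl⟩⟩
  map_add' p q := by
    apply Subtype.ext
    apply (WithLp.equiv 2 _).injective
    exact Prod.ext (D.ι.map_add p q) (Subtype.ext (D.L.map_add p q))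
  map_smul' c p := by
    apply Subtype.ext
    apply (WithLp.equiv 2 _).injective
    exact Prod.ext (D.ι.map_smul c p) (Subtype.ext (D.L.map_smul c p))

theorem ofParam_bijective : Function.Bijective D.ofParam := by
  constructor
  · intro p q h
    apply D.ι_inj
    exact congrArg (fun f : Plus D.A => (f : WithLp 2 (H × domClosure D.A)).fst) h
  · intro f
    obtain ⟨p, hp, hp'⟩ := D.mem_plusSubmodule.1 f.2
    refine ⟨p, Subtype.ext ?_⟩
    apply (WithLp.equiv 2 _).injective
    exact Prod.ext hp (Subtype.ext hp')

/-- The parameter of an element of `H₊`. -/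
def param : Plus D.A ≃ₗ[ℂ] P := (LinearEquiv.ofBijective D.ofParam D.ofParam_bijective).symm

theorem ofParam_param (f : Plus D.A) : D.ofParam (D.param f) = f :=
  (LinearEquiv.ofBijective D.ofParam D.ofParam_bijective).apply_symm_apply f

theorem ι_param (f : Plus D.A) : D.ι (D.param f) = incl D.A f := by
  conv_rhs => rw [← D.ofParam_param f]
  rfl

theorem incl_injective : Function.Injective (incl D.A) := by
  intro f g h
  rw [← ι_param, ← ι_param] at h
  exact D.param.injective (D.ι_inj h)

theorem incl_param_symm (p : P) : incl D.A (D.param.symm p) = D.ι p := by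
  rw [← ι_param, LinearEquiv.apply_symm_apply]

/-- The adjoint `A*` on `H₊`, with values in `H`. -/
def maxOp : Plus D.A →L[ℂ] H :=
  ((domClosure D.A).subtypeL.comp (WithLp.sndL 2 ℂ H (domClosure D.A))).comp
    (plusSubmodule D.A).subtypeL

theorem L_param (f : Plus D.A) : D.L (D.param f) = D.maxOp f := by
  conv_rhs => rw [← D.ofParam_param f]
  rfl

theorem plus_inner (f g : Plus D.A) :
    inner ℂ f g = inner ℂ (incl D.A f) (incl D.A g) + inner ℂ (D.maxOp f) (D.maxOp g) :=
  WithLp.prod_inner_apply _ _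

theorem exists_bdry (e e' : E) : ∃ p, D.Γ₀ p = e ∧ D.Γ₁ p = e' := by
  obtain ⟨p, -, hp⟩ := D.solv I (by simp) 0 e
  obtain ⟨q, hq, hq'⟩ := D.surj (e' - D.Γ₁ p)
  exact ⟨p + q, by rw [map_add, hp, hq, add_zero], by rw [map_add, hq']; abel⟩

theorem continuous_of_inner {X : Type*} [TopologicalSpace X] {f : X → E}
    (h : ∀ e, Continuous fun x => inner ℂ e (f x)) : Continuous f := by
  have : f = fun x => ∑ i, inner ℂ (stdOrthonormalBasis ℂ E i) (f x) • stdOrthonormalBasis ℂ E i :=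
    funext fun x => ((stdOrthonormalBasis ℂ E).sum_repr' (f x)).symm
  rw [this]
  exact continuous_finsetSum _ fun i _ => (h _).smul continuous_const

/-- Green's identity replaces the boundary values by `ι` and `L`, which are continuous on `H₊`.
Since the pair `(Γ₀ p, Γ₁ p)` is arbitrary, this makes both boundary maps continuous. -/
theorem continuous_green (p : P) : Continuous fun f : Plus D.A =>
    inner ℂ (D.Γ₀ p) (D.Γ₁ (D.param f)) - inner ℂ (D.Γ₁ p) (D.Γ₀ (D.param f)) := by
  simp only [← D.green, ι_param, L_param]
  fun_prop

/-- The boundary map `Γ₀` on `H₊`. -/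
def b₀ : Plus D.A →L[ℂ] E where
  toLinearMap := D.Γ₀ ∘ₗ D.param.toLinearMap
  cont := by
    refine continuous_of_inner fun e => ?_
    obtain ⟨p, h0, h1⟩ := D.exists_bdry 0 (-e)
    simpa [h0, h1] using D.continuous_green p

/-- The boundary map `Γ₁` on `H₊`. -/
def b₁ : Plus D.A →L[ℂ] E where
  toLinearMap := D.Γ₁ ∘ₗ D.param.toLinearMap
  cont := by
    refine continuous_of_inner fun e => ?_
    obtain ⟨p, h0, h1⟩ := D.exists_bdry e 0
    simpa [h0, h1] using D.continuous_green p

theorem b₁_apply (f : Plus D.A) : D.b₁ f = D.Γ₁ (D.param f) := rfl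

theorem norm_incl_le (f : Plus D.A) : ‖incl D.A f‖ ≤ ‖f‖ := by
  have h1 : ‖incl D.A f‖ ^ 2 ≤ ‖f‖ ^ 2 := by
    have := WithLp.prod_norm_sq_eq_of_L2 (f : WithLp 2 (H × domClosure D.A))
    rw [Submodule.coe_norm, this]
    exact le_add_of_nonneg_right (by positivity)
  exact (pow_le_pow_iff_left₀ (norm_nonneg _) (norm_nonneg _) two_ne_zero).1 h1

theorem norm_embed_le (h : H) : ‖embed D.A h‖ ≤ ‖h‖ := by
  refine ContinuousLinearMap.opNorm_le_bound (embed D.A h) (norm_nonneg h) fun f => ?_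
  rw [embed_apply, mul_comm]
  exact (norm_inner_le_norm (𝕜 := ℂ) _ _).trans
    (mul_le_mul_of_nonneg_right (D.norm_incl_le f) (norm_nonneg h))

/-- The inclusion of `H` into `H₋` as a continuous map. -/
def embedL : H →L[ℂ] Minus D.A where
  toLinearMap := embed D.A
  cont := AddMonoidHomClass.continuous_of_bound (embed D.A) 1 fun h =>
    (D.norm_embed_le h).trans (one_mul _).ge

/-- The channel map `K`, adjoint to `Γ₁`. -/
def K : E →L[ℂ] Minus D.A :=
  LinearMap.toContinuousLinearMap
    { toFun e := ((innerSL ℂ).flip e).comp D.b₁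
      map_add' e e' := by ext f; simp
      map_smul' c e := by ext f; simp }

theorem K_apply (e : E) (f : Plus D.A) : D.K e f = inner ℂ (D.b₁ f) e := rfl

theorem kAdj_K (f : Plus D.A) : kAdj D.K f = D.b₁ f := by
  refine ext_inner_right ℂ fun e => ?_
  rw [inner_kAdj, K_apply]

/-- The operator `A* + K (Γ₀ + θ Γ₁)` from `H₊` to `H₋`. -/
def B (θ : ℂ) : Plus D.A →L[ℂ] Minus D.A :=
  D.embedL.comp D.maxOp + D.K.comp (D.b₀ + θ • D.b₁)

theorem B_eq (θ : ℂ) (f : Plus D.A) :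
    D.B θ f = embed D.A (D.maxOp f) + D.K (D.bdry θ (D.param f)) := rfl

theorem B_apply (θ : ℂ) (f g : Plus D.A) :
    D.B θ f g = inner ℂ (D.ι (D.param g)) (D.L (D.param f)) +
      inner ℂ (D.Γ₁ (D.param g)) (D.bdry θ (D.param f)) := by
  rw [B_eq, ι_param, L_param]; rfl

theorem bAdj_B (θ : ℂ) : bAdj (D.B θ) = D.B (conj θ) := by
  ext f g
  rw [bAdj_apply, B_apply, B_apply, map_add, inner_conj_symm, inner_conj_symm]
  have := D.green_bdry (conj θ) 0 (D.param f) (D.param g)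
  simp only [map_zero, zero_smul, sub_zero, conj_conj] at this
  exact this.symm

theorem rePart_B : rePart (D.B I) = D.B 0 := by
  rw [rePart, bAdj_B, conj_I]
  ext f g
  simp only [smul_apply, add_apply, B_apply, bdry_apply, inner_add_right,
    inner_smul_right, smul_eq_mul]
  ring

theorem im_B : D.B I - bAdj (D.B I) =
    (2 * I) • (D.K.comp ((1 : E →L[ℂ] E).comp (kAdj D.K))) := by
  rw [bAdj_B, conj_I]
  ext f g
  simp only [sub_apply, smul_apply, B_apply, bdry_apply, inner_add_right, inner_smul_right,
    smul_eq_mul, ContinuousLinearMap.comp_apply, kAdj_K, K_apply, b₁_apply,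
    one_apply_eq_self]
  ring

/-- Testing on the domain of `A`, where `Γ₁` vanishes, gives `h = 0` by density; surjectivity of
`Γ₁` then gives `e = 0`. No nonzero channel vector lies in `H`, so equations in `H₋` split into an
equation in `H` and a boundary condition. -/
theorem embed_add_K_eq_zero {h : H} {e : E} (he : embed D.A h + D.K e = 0) : h = 0 ∧ e = 0 := by
  have h1 : ∀ p, inner ℂ (D.ι p) h + inner ℂ (D.Γ₁ p) e = 0 := by
    intro p
    have := DFunLike.congr_fun he (D.param.symm p)
    rw [add_apply, embed_apply, K_apply, b₁_apply, incl_param_symm,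
      LinearEquiv.apply_symm_apply] at this
    exact this
  have hh : h = 0 := by
    rw [← Submodule.mem_bot ℂ, ← Submodule.topologicalClosure_eq_top_iff.1 D.domClosure_eq_top,
      Submodule.mem_orthogonal]
    intro v hv
    obtain ⟨p, -, hp1, hp, -⟩ := D.exists_of_mem_domain_A ⟨v, hv⟩
    have := h1 p
    rwa [hp1, hp, inner_zero_left, add_zero] at this
  refine ⟨hh, ?_⟩
  obtain ⟨p, -, hp⟩ := D.surj e
  have := h1 p
  rw [hp, hh, inner_zero_right, zero_add] at this
  exact inner_self_eq_zero.1 this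

theorem K_injective : Function.Injective D.K := by
  rw [injective_iff_map_eq_zero]
  intro e he
  exact (D.embed_add_K_eq_zero (h := 0) (by rw [map_zero, zero_add, he])).2

theorem embed_add_K_inj {h h' : H} {e e' : E}
    (he : embed D.A h + D.K e = embed D.A h' + D.K e') : h = h' ∧ e = e' := by
  have := D.embed_add_K_eq_zero (h := h - h') (e := e - e') (by
    rw [map_sub, map_sub, sub_add_sub_comm, he, sub_self])
  exact ⟨sub_eq_zero.1 this.1, sub_eq_zero.1 this.2⟩

theorem pencil_eq (θ z : ℂ) (f : Plus D.A) : pencil (D.B θ) D.F z f =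
    embed D.A (D.L (D.param f) - z • D.F (D.ι (D.param f))) + D.K (D.bdry θ (D.param f)) := by
  rw [map_sub, map_smul, L_param, ι_param]
  change D.B θ f - z • embed D.A (D.F (incl D.A f)) = _
  rw [B_eq]; abel

theorem pencil_eq_iff {θ z : ℂ} {f : Plus D.A} {h : H} {e : E} :
    pencil (D.B θ) D.F z f = embed D.A h + D.K e ↔
      D.L (D.param f) - z • D.F (D.ι (D.param f)) = h ∧ D.bdry θ (D.param f) = e := by
  rw [pencil_eq]
  exact ⟨D.embed_add_K_inj, fun ⟨h1, h2⟩ => by rw [h1, h2]⟩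

theorem extends_T (θ : ℂ) : Extends (D.B θ) (D.T θ) := by
  intro x
  obtain ⟨p, hp, h, h'⟩ := D.exists_of_mem_domain_T x
  refine ⟨D.param.symm p, by rw [incl_param_symm, h], ?_⟩
  rw [B_eq, LinearEquiv.apply_symm_apply, hp, map_zero, add_zero, ← L_param,
    LinearEquiv.apply_symm_apply, h']

theorem extends_A (θ : ℂ) : Extends (D.B θ) D.A := by
  intro x
  obtain ⟨p, hp, hp', h, h'⟩ := D.exists_of_mem_domain_A x
  refine ⟨D.param.symm p, by rw [incl_param_symm, h], ?_⟩
  rw [B_eq, LinearEquiv.apply_symm_apply, bdry_apply, hp, hp', smul_zero, add_zero, map_zero,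
    add_zero, ← L_param, LinearEquiv.apply_symm_apply, h']

theorem inducedGraph_B (θ : ℂ) : ((D.T θ).graph : Set (H × H)) = inducedGraph (D.B θ) := by
  ext x
  rw [SetLike.mem_coe, mem_graph_T]
  constructor
  · rintro ⟨p, hp, h, h'⟩
    refine ⟨D.param.symm p, by rw [incl_param_symm, h], ?_⟩
    rw [B_eq, LinearEquiv.apply_symm_apply, hp, map_zero, add_zero, ← L_param,
      LinearEquiv.apply_symm_apply, h']
  · rintro ⟨f, hf, hf'⟩
    rw [B_eq, ← add_zero (embed D.A x.2), ← map_zero D.K] at hf'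
    obtain ⟨h1, h2⟩ := D.embed_add_K_inj hf'
    exact ⟨D.param f, h2, by rw [ι_param, hf], by rw [L_param, h1]⟩

theorem isSelfAdjointBiExtension : IsSelfAdjointBiExtension (D.B 0) where
  biExtension := ⟨D.extends_A 0, by rw [bAdj_B]; exact D.extends_A _⟩
  symm := by rw [bAdj_B, map_zero]
  induced := ⟨D.T 0, D.inducedGraph_B 0, D.A_le_T 0, D.adjoint_T_zero⟩

theorem isCorrectStarExtension : IsCorrectStarExtension (D.T I) (D.B I) where
  ext := D.extends_T I
  ext_adj := by rw [adjoint_T_I, bAdj_B, conj_I]; exact D.extends_T _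
  correct := by rw [rePart_B]; exact D.isSelfAdjointBiExtension

theorem isOrthProjInBoth : IsOrthProjInBoth D.A D.F := by
  refine ⟨D.F_proj, ?_⟩
  have hG : ∀ f : Plus D.A, ∃ g : Plus D.A, incl D.A g = D.F (incl D.A f) ∧
      D.maxOp g = D.F' (D.maxOp f) := by
    intro f
    obtain ⟨q, hq, hq'⟩ := D.reduces (D.param f)
    refine ⟨D.param.symm q, ?_, ?_⟩
    · rw [incl_param_symm, hq, ι_param]
    · rw [← L_param, LinearEquiv.apply_symm_apply, hq', L_param]
  choose G hG hG' using hG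
  refine ⟨⟨⟨G, fun f g => ?_⟩, fun c f => ?_⟩, ⟨?_, ?_⟩, hG⟩
  · apply D.incl_injective
    rw [hG, map_add, map_add, map_add, hG, hG]
  · apply D.incl_injective
    rw [hG, map_smul, map_smul, map_smul, hG]; rfl
  · ext1 f
    apply D.incl_injective
    change incl D.A (G (G f)) = incl D.A (G f)
    rw [hG, hG, F_F]
  · intro f g
    change inner ℂ (G f) g = inner ℂ f (G g)
    rw [plus_inner, plus_inner, hG, hG, hG', hG', F_symm]
    congr 1
    -- Symmetry for the graph inner product also involves the `A*` components, on which the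
    -- projection acts as the symmetric operator `F'`.
    exact D.F'_symm _ _

end Rigging

end BoundarySystem

/-! ### The sets `ρ`, the system and its transfer function. -/

namespace BoundarySystem

section Resolvent

variable {P H E : Type*} [AddCommGroup P] [Module ℂ P]
    [NormedAddCommGroup H] [InnerProductSpace ℂ H] [CompleteSpace H]
    [NormedAddCommGroup E] [InnerProductSpace ℂ E] [FiniteDimensional ℂ E]
    (D : BoundarySystem P H E)

theorem minus_norm_zero : ‖(0 : Minus D.A)‖ = 0 := ContinuousLinearMap.opNorm_zero

theorem minus_norm_add_le (φ ψ : Minus D.A) : ‖φ + ψ‖ ≤ ‖φ‖ + ‖ψ‖ :=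
  ContinuousLinearMap.opNorm_add_le φ ψ

theorem minus_norm_smul_le (c : ℂ) (φ : Minus D.A) : ‖c • φ‖ ≤ ‖c‖ * ‖φ‖ :=
  ContinuousLinearMap.opNorm_smul_le c φ

theorem minus_norm_pos {φ : Minus D.A} (h : φ ≠ 0) : 0 < ‖φ‖ :=
  norm_pos_iff (E := Plus D.A →L⋆[ℂ] ℂ).2 h

theorem pencil_apply (B : Plus D.A →L[ℂ] Minus D.A) (z : ℂ) (f : Plus D.A) :
    pencil B D.F z f = B f - z • embed D.A (D.F (incl D.A f)) := rfl

theorem exists_resolvent {B : Plus D.A →L[ℂ] Minus D.A} {z : ℂ} (hz : z ∈ rho B D.F D.K) :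
    ∃ R : H →L[ℂ] H, ∀ f h, pencil B D.F z f = embed D.A h → R h = incl D.A f := by
  obtain ⟨hinj, hH, -, C, hC⟩ := hz
  set s := LinearMap.codRestrictOfInjective (embed D.A) (pencil B D.F z) hinj hH
  have hs : ∀ h, pencil B D.F z (s h) = embed D.A h :=
    LinearMap.codRestrictOfInjective_comp_apply _ _ hinj hH
  have hC0 : ∀ h, ‖incl D.A (s h)‖ ≤ max C 0 * ‖h‖ := by
    intro h
    have h1 := hC (s h) (by rw [hs]; exact Submodule.mem_sup_left ⟨h, rfl⟩)
    rw [hs] at h1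
    calc _ ≤ C * ‖embed D.A h‖ := h1
      _ ≤ max C 0 * ‖embed D.A h‖ :=
        mul_le_mul_of_nonneg_right (le_max_left _ _) (ContinuousLinearMap.opNorm_nonneg _)
      _ ≤ max C 0 * ‖h‖ := mul_le_mul_of_nonneg_left (D.norm_embed_le h) (le_max_right _ _)
  refine ⟨LinearMap.mkContinuous ((incl D.A : Plus D.A →ₗ[ℂ] H) ∘ₗ s) _ hC0, fun f h hf => ?_⟩
  change incl D.A (s h) = incl D.A f
  congr 1
  apply hinj
  rw [hs, hf]

/-- A Neumann series argument: a change of `z` by `δ` perturbs the pencil by `δ F`, which has values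
in `H`, and there the inverse is a bounded operator `R` on `H`. Only invertibility of `1 - δ R F` is
needed. -/
theorem isOpen_rho (B : Plus D.A →L[ℂ] Minus D.A) : IsOpen (rho B D.F D.K) := by
  rw [Metric.isOpen_iff]
  intro z hz
  obtain ⟨R, hR⟩ := D.exists_resolvent hz
  obtain ⟨hinj, hH, hK, C₀, hC₀⟩ := hz
  set C := max C₀ 0 with hCdef
  have hC : ∀ f, pencil B D.F z f ∈ LinearMap.range (embed D.A) ⊔
      LinearMap.range (D.K : E →ₗ[ℂ] Minus D.A) → ‖incl D.A f‖ ≤ C * ‖pencil B D.F z f‖ := by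
    intro f hf
    exact (hC₀ f hf).trans
      (mul_le_mul_of_nonneg_right (le_max_left _ _) (ContinuousLinearMap.opNorm_nonneg _))
  have hC0 : 0 ≤ C := le_max_right _ _
  -- The first summand controls the a priori bound after perturbation, the second the Neumann
  -- series; the last keeps `M` positive.
  set M := C * ‖D.F‖ + ‖R.comp D.F‖ + 1 with hM
  have hMpos : 0 < M := by positivity
  refine ⟨1 / (2 * M), by positivity, fun w hw => ?_⟩
  set δ := w - z with hδ
  have hδM : ‖δ‖ * M < 1 / 2 := by
    rw [mem_ball_iff_norm, lt_div_iff₀ (by positivity)] at hw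
    linarith
  have hpen : ∀ f, pencil B D.F w f = pencil B D.F z f - δ • embed D.A (D.F (incl D.A f)) := by
    intro f
    rw [pencil_apply, pencil_apply, hδ]; module
  have hbound : ∀ f, pencil B D.F w f ∈ LinearMap.range (embed D.A) ⊔
      LinearMap.range (D.K : E →ₗ[ℂ] Minus D.A) →
      ‖incl D.A f‖ ≤ (2 * C) * ‖pencil B D.F w f‖ := by
    intro f hf
    have h1 : pencil B D.F z f = pencil B D.F w f + δ • embed D.A (D.F (incl D.A f)) := by
      rw [hpen]; abel
    have h2 := hC f (by
      rw [h1]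
      exact add_mem hf (Submodule.smul_mem _ _ (Submodule.mem_sup_left ⟨_, rfl⟩)))
    have h3 : ‖pencil B D.F z f‖ ≤ ‖pencil B D.F w f‖ + ‖δ‖ * (‖D.F‖ * ‖incl D.A f‖) := by
      rw [h1]
      refine (D.minus_norm_add_le _ _).trans ?_
      refine add_le_add_right ((D.minus_norm_smul_le _ _).trans ?_) _
      gcongr
      exact (D.norm_embed_le _).trans (D.F.le_opNorm _)
    have h4 : ‖δ‖ * (C * ‖D.F‖) ≤ 1 / 2 := by
      refine le_trans ?_ hδM.le
      gcongr
      rw [hM]; linarith [norm_nonneg (R.comp D.F)]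
    have h5 : C * ‖pencil B D.F z f‖ ≤
        C * ‖pencil B D.F w f‖ + ‖δ‖ * (C * ‖D.F‖) * ‖incl D.A f‖ := by
      calc _ ≤ C * (‖pencil B D.F w f‖ + ‖δ‖ * (‖D.F‖ * ‖incl D.A f‖)) := by gcongr
        _ = _ := by ring
    have h6 := mul_le_mul_of_nonneg_right h4 (norm_nonneg (incl D.A f))
    linarith
  have hsolve : ∀ f₀, ∃ f, pencil B D.F w f = pencil B D.F z f₀ := by
    intro f₀
    have hu : IsUnit (1 - δ • R.comp D.F) := by
      apply isUnit_one_sub_of_norm_lt_one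
      rw [norm_smul]
      have : ‖δ‖ * ‖R.comp D.F‖ ≤ ‖δ‖ * M := by
        gcongr
        rw [hM]; nlinarith [norm_nonneg D.F]
      linarith
    obtain ⟨u, hu⟩ := hu
    -- The component in `H` of the perturbed solution must satisfy `x = f₀ + δ R F x`; the lift to
    -- `H₊` adds `δ` times the preimage `s` of `F x`.
    set x := (↑u⁻¹ : H →L[ℂ] H) (incl D.A f₀) with hx
    have hux : x - δ • R (D.F x) = incl D.A f₀ := by
      have : (u : H →L[ℂ] H) x = incl D.A f₀ := by
        rw [hx, ← mul_apply_eq_comp, u.mul_inv, one_apply_eq_self]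
      rw [hu] at this
      exact this
    obtain ⟨s, hs⟩ := hH (D.F x)
    refine ⟨f₀ + δ • s, ?_⟩
    have h1 : incl D.A (f₀ + δ • s) = x := by
      rw [map_add, map_smul, ← hR s _ hs, ← hux]; abel
    rw [hpen, h1, map_add, map_smul, hs]; abel
  refine ⟨?_, ?_, ?_, 2 * C, hbound⟩
  · rw [injective_iff_map_eq_zero]
    intro f hf
    apply D.incl_injective
    have := hbound f (by rw [hf]; exact zero_mem _)
    rw [hf, D.minus_norm_zero, mul_zero, norm_le_zero_iff] at this
    rw [this, map_zero]
  · intro h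
    obtain ⟨f₀, hf₀⟩ := hH h
    obtain ⟨f, hf⟩ := hsolve f₀
    exact ⟨f, hf.trans hf₀⟩
  · intro e
    obtain ⟨f₀, hf₀⟩ := hK e
    obtain ⟨f, hf⟩ := hsolve f₀
    exact ⟨f, hf.trans hf₀⟩

variable {D}

theorem Solvable.exists_pencil {θ z : ℂ} (h : D.Solvable θ z) (x : H) (e : E) :
    ∃ f, pencil (D.B θ) D.F z f = embed D.A x + D.K e := by
  obtain ⟨p, hp, hp'⟩ := h x e
  refine ⟨D.param.symm p, ?_⟩
  rw [pencil_eq_iff, LinearEquiv.apply_symm_apply]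
  exact ⟨hp, hp'⟩

/-- For the bound from `H₋` to `H`, let `q` solve the adjoint problem with right-hand side `x` and
zero boundary value. Green's identity expresses `(x, f)` as the pencil of `f` evaluated at `q`, so
it is bounded by `‖q‖₊` when the pencil of `f` has norm at most one. Uniform boundedness in `x`
finishes. -/
theorem Solvable.mem_rho {θ z : ℂ} (h : D.Solvable θ z)
    (h' : D.Solvable (conj θ) (conj z)) : z ∈ rho (D.B θ) D.F D.K := by
  have hinj : Function.Injective (pencil (D.B θ) D.F z) := by
    rw [injective_iff_map_eq_zero]
    intro f hf
    have hf' : pencil (D.B θ) D.F z f = embed D.A 0 + D.K 0 := by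
      rw [hf, map_zero, map_zero, add_zero]
    obtain ⟨h1, h2⟩ := D.pencil_eq_iff.1 hf'
    exact D.param.injective ((h'.unique h1 h2).trans (map_zero _).symm)
  refine ⟨hinj, fun x => ?_, fun e => ?_, ?_⟩
  · obtain ⟨f, hf⟩ := h.exists_pencil x 0
    exact ⟨f, by rw [hf, map_zero, add_zero]⟩
  · obtain ⟨f, hf⟩ := h.exists_pencil 0 e
    exact ⟨f, by rw [hf, map_zero, zero_add]⟩
  · set g : {f : Plus D.A // ‖pencil (D.B θ) D.F z f‖ ≤ 1} → (H →L[ℂ] ℂ) :=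
      fun f => innerSL ℂ (incl D.A f) with hg
    have hpt : ∀ x, ∃ C, ∀ i, ‖g i x‖ ≤ C := by
      intro x
      obtain ⟨q, hq, hq'⟩ := h' x 0
      refine ⟨‖D.param.symm q‖, fun i => ?_⟩
      have h1 := D.green_bdry θ z (D.param i) q
      rw [hq, hq', inner_zero_left, add_zero] at h1
      have h2 : pencil (D.B θ) D.F z i (D.param.symm q) = inner ℂ x (D.ι (D.param i)) := by
        rw [← h1, pencil_eq, add_apply, embed_apply, K_apply, b₁_apply,
          incl_param_symm, LinearEquiv.apply_symm_apply]
      rw [hg]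
      change ‖inner ℂ (incl D.A i) x‖ ≤ _
      rw [← inner_conj_symm, RCLike.norm_conj, ← ι_param, ← h2]
      calc _ ≤ ‖pencil (D.B θ) D.F z i‖ * ‖D.param.symm q‖ :=
            ContinuousLinearMap.le_opNorm _ _
        _ ≤ 1 * ‖D.param.symm q‖ := by gcongr; exact i.2
        _ = _ := one_mul _
    obtain ⟨C, hC⟩ := banach_steinhaus hpt
    refine ⟨C, fun f _ => ?_⟩
    rcases eq_or_ne (pencil (D.B θ) D.F z f) 0 with h0 | h0
    · have : f = 0 := hinj (h0.trans (map_zero _).symm)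
      rw [this, map_zero, map_zero, norm_zero, D.minus_norm_zero, mul_zero]
    · have hn : 0 < ‖pencil (D.B θ) D.F z f‖ := D.minus_norm_pos h0
      set n := ‖pencil (D.B θ) D.F z f‖ with hndef
      have hnC : ‖((n⁻¹ : ℝ) : ℂ)‖ = n⁻¹ := by
        rw [norm_real, Real.norm_of_nonneg (by positivity)]
      have h1 : ‖pencil (D.B θ) D.F z (((n⁻¹ : ℝ) : ℂ) • f)‖ ≤ 1 := by
        rw [map_smul]
        refine (D.minus_norm_smul_le _ _).trans ?_
        rw [hnC, ← hndef, inv_mul_cancel₀ hn.ne']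
      have h2 := hC ⟨_, h1⟩
      simp only [hg, innerSL_apply_norm, map_smul, norm_smul, hnC] at h2
      rw [inv_mul_le_iff₀ hn] at h2
      linarith

variable (D) in
theorem solvable_of_mem_rho {θ z : ℂ} (hz : z ∈ rho (D.B θ) D.F D.K) : D.Solvable θ z := by
  intro h e
  obtain ⟨-, hH, hK, -⟩ := hz
  obtain ⟨f, hf⟩ := hH h
  obtain ⟨g, hg⟩ := hK e
  exact ⟨D.param (f + g), D.pencil_eq_iff.1 (by rw [map_add, hf, hg])⟩

/-- The point `z` is any element of `ρ`, possibly real. The adjoint of its resolvent supplies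
solutions at `conj z` with zero boundary value; the auxiliary point `z₀` is used to identify the
adjoint operator and to prescribe boundary values. -/
theorem Solvable.conj_mem_rho {θ z₀ z : ℂ} (h : D.Solvable θ z₀)
    (h' : D.Solvable (conj θ) (conj z₀)) (hz : z ∈ rho (D.B θ) D.F D.K) :
    conj z ∈ rho (D.B (conj θ)) D.F D.K := by
  suffices hs : D.Solvable (conj θ) (conj z) from
    hs.mem_rho (by simpa using D.solvable_of_mem_rho hz)
  obtain ⟨R, hR⟩ := D.exists_resolvent hz
  have h0 : ∀ x, ∃ q, D.L q - conj z • D.F (D.ι q) = x ∧ D.bdry (conj θ) q = 0 := by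
    intro x
    -- With `R` inverting the pencil at `z`, the vector `R* x` satisfies the weak form of the
    -- adjoint equation at `conj z`.
    set y := ContinuousLinearMap.adjoint R x
    obtain ⟨q, hq, hqy, hqw⟩ := h.exists_of_adjoint h' (y := y) (w := x + conj z • D.F y)
      (fun p hp => by
        have h1 : R (D.L p - z • D.F (D.ι p)) = D.ι p := by
          rw [hR (D.param.symm p) _, incl_param_symm]
          have := (D.pencil_eq_iff (θ := θ) (z := z) (f := D.param.symm p)
            (h := D.L p - z • D.F (D.ι p)) (e := 0)).2 (by
              rw [LinearEquiv.apply_symm_apply]; exact ⟨rfl, hp⟩)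
          rw [this, map_zero, add_zero]
        have h2 : inner ℂ y (D.L p - z • D.F (D.ι p)) = inner ℂ x (D.ι p) := by
          rw [ContinuousLinearMap.adjoint_inner_left, h1]
        rw [inner_sub_right, inner_smul_right] at h2
        rw [inner_add_left, inner_smul_left, conj_conj, D.F_symm, ← h2]
        ring)
    refine ⟨q, ?_, hq⟩
    rw [hqw, hqy]; abel
  intro x e
  obtain ⟨q₀, -, hq₀⟩ := h' 0 e
  obtain ⟨q, hq, hq'⟩ := h0 (x - (D.L q₀ - conj z • D.F (D.ι q₀)))
  refine ⟨q + q₀, ?_, by rw [map_add, hq', hq₀, zero_add]⟩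
  rw [map_add, map_add, map_add, smul_add, add_sub_add_comm, hq, sub_add_cancel]

variable (D)

/-- The `F₊`-system of a boundary system. -/
def system : FPlusSystem H E where
  A := D.A
  A_closed := D.isClosed_A
  A_symm := D.A_symm
  T := D.T I
  T_mem := D.omegaClass
  B := D.B I
  B_correct := D.isCorrectStarExtension
  J := 1
  J_symm := fun _ _ => rfl
  J_sq := one_mul 1
  K := D.K
  K_inj := D.K_injective
  im_eq := D.im_B
  F := D.F
  F_proj := D.isOrthProjInBoth
  rho_open := D.isOpen_rho _
  rho_re_open := D.isOpen_rho _
  rho_inter_open := (D.isOpen_rho _).inter (D.isOpen_rho _)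
  rho_conj := fun z hz => by
    rw [bAdj_B]
    exact (D.solvable_I (z := -I) (by simp)).conj_mem_rho
      (by simpa using D.solvable_neg_I (z := I) (by simp)) hz
  rho_re_conj := fun z hz => by
    rw [rePart_B] at hz ⊢
    have := (D.solvable_zero (z := I) (by simp)).conj_mem_rho
      (by simpa using D.solvable_zero (z := -I) (by simp)) hz
    rwa [map_zero] at this

theorem mem_resolventSet {z : ℂ} (hz : z.im < 0) : z ∈ D.system.resolventSet :=
  (D.solvable_I hz).mem_rho (by simpa using D.solvable_neg_I (z := conj z) (by simpa using hz))

theorem exists_transfer_apply {z : ℂ} (hz : z ∈ D.system.resolventSet) (e : E) :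
    ∃ p, D.L p = z • D.F (D.ι p) ∧ D.Γ₀ p + I • D.Γ₁ p = e ∧
      D.system.transfer z e = e - (2 * I) • D.Γ₁ p := by
  have hz' : z ∈ rho (D.B I) D.F D.K := hz
  set f := resolventK (D.B I) D.F D.K z e with hf
  have h1 : pencil (D.B I) D.F z f = D.K e := by
    rw [hf, resolventK, dif_pos hz']
    exact LinearMap.codRestrictOfInjective_comp_apply _ _ hz'.1 hz'.2.2.1 e
  have h2 := D.pencil_eq_iff.1 (h1.trans (by rw [map_zero (embed D.A), zero_add]) :
    pencil (D.B I) D.F z f = embed D.A 0 + D.K e)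
  refine ⟨D.param f, sub_eq_zero.1 h2.1, h2.2, ?_⟩
  rw [← b₁_apply, ← kAdj_K]
  rfl

theorem mul_eq_one_comm_of_finite {a b : E →L[ℂ] E} (h : a * b = 1) : b * a = 1 := by
  have h1 : (a : E →ₗ[ℂ] E) * (b : E →ₗ[ℂ] E) = 1 := by
    ext x; exact DFunLike.congr_fun h x
  have h2 := mul_eq_one_comm.1 h1
  ext x
  exact DFunLike.congr_fun h2 x

/-- For the solution `p` belonging to `e` one has `e = (1 + iV) Γ₀ p` and `½ (W + 1) e = Γ₀ p`. Thus
`½ (W + 1)` is a right inverse of `1 + iV`, two-sided by finite dimension, and the rest is the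
algebra of the Cayley transform. -/
theorem transfer_spec {V : ℂ → E →L[ℂ] E} {z : ℂ}
    (hV : ∀ p, D.L p = z • D.F (D.ι p) → D.Γ₁ p = V z (D.Γ₀ p))
    (hz : z ∈ D.system.resolventSet) :
    IsUnit (D.system.transfer z + 1) ∧
      V z = I • (Ring.inverse (D.system.transfer z + 1) * (D.system.transfer z - 1)) := by
  set W := D.system.transfer z with hW
  have h1 : (1 + I • V z) * ((1 / 2 : ℂ) • (W + 1)) = 1 := by
    ext e
    obtain ⟨p, hp, he, hWe⟩ := D.exists_transfer_apply hz e
    have h2 : ((1 / 2 : ℂ) • (W + 1)) e = D.Γ₀ p := by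
      rw [smul_apply, add_apply, one_apply_eq_self, hWe, ← he]
      module
    rw [mul_apply_eq_comp, h2, add_apply, one_apply_eq_self, smul_apply, ← hV p hp, he,
      one_apply_eq_self]
  have h2 := mul_eq_one_comm_of_finite h1
  have h3 : (W + 1) * ((1 / 2 : ℂ) • (1 + I • V z)) = 1 := by
    rw [mul_smul_comm, ← smul_mul_assoc, h2]
  have h4 := mul_eq_one_comm_of_finite h3
  set u : (E →L[ℂ] E)ˣ := ⟨W + 1, (1 / 2 : ℂ) • (1 + I • V z), h3, h4⟩
  have hu : IsUnit (W + 1) := u.isUnit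
  refine ⟨hu, ?_⟩
  have h5 : W - 1 = (W + 1) * ((-I) • V z) := by
    have h6 : (W + 1) * (1 + I • V z) = (2 : ℂ) • (1 : E →L[ℂ] E) := by
      have h7 := congrArg ((2 : ℂ) • ·) h3
      simpa only [mul_smul_comm, smul_smul, mul_one_div_cancel (two_ne_zero' ℂ), one_smul] using h7
    rw [mul_add, mul_one] at h6
    rw [neg_smul, mul_neg, ← sub_eq_iff_eq_add'.2 h6.symm]
    module
  rw [h5, ← mul_assoc, Ring.inverse_mul_cancel _ hu, one_mul, smul_smul]
  simp

end Resolvent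

end BoundarySystem

/-! ### The concrete model: orthogonal sums, state space and boundary maps. -/

section FstProj

variable {X Y : Type*} [NormedAddCommGroup X] [InnerProductSpace ℂ X]
    [NormedAddCommGroup Y] [InnerProductSpace ℂ Y]

/-- The orthogonal sum of two bounded operators. -/
def dsum (S : X →L[ℂ] X) (T : Y →L[ℂ] Y) : WithLp 2 (X × Y) →L[ℂ] WithLp 2 (X × Y) :=
  ((WithLp.prodContinuousLinearEquiv 2 ℂ X Y).symm : X × Y →L[ℂ] WithLp 2 (X × Y)).comp
    ((S.prodMap T).comp
      ((WithLp.prodContinuousLinearEquiv 2 ℂ X Y) : WithLp 2 (X × Y) →L[ℂ] X × Y))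

theorem dsum_apply (S : X →L[ℂ] X) (T : Y →L[ℂ] Y) (x : X) (y : Y) :
    dsum S T (WithLp.toLp 2 (x, y)) = WithLp.toLp 2 (S x, T y) := rfl

theorem isSymmetric_dsum {S : X →L[ℂ] X} {T : Y →L[ℂ] Y} (hS : (S : X →ₗ[ℂ] X).IsSymmetric)
    (hT : (T : Y →ₗ[ℂ] Y).IsSymmetric) :
    (dsum S T : WithLp 2 (X × Y) →ₗ[ℂ] WithLp 2 (X × Y)).IsSymmetric := by
  rintro ⟨x, y⟩ ⟨x', y'⟩
  simp only [ContinuousLinearMap.coe_coe, dsum_apply, WithLp.prod_inner_apply]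
  exact congrArg₂ _ (hS x x') (hT y y')

theorem isSymmetricProjection_dsum_one_zero :
    (dsum (1 : X →L[ℂ] X) (0 : Y →L[ℂ] Y) :
      WithLp 2 (X × Y) →ₗ[ℂ] WithLp 2 (X × Y)).IsSymmetricProjection := by
  refine ⟨?_, isSymmetric_dsum (fun _ _ => rfl) fun _ _ => ?_⟩
  · refine LinearMap.ext ?_
    rintro ⟨x, y⟩
    rfl
  · simp

end FstProj

/-- Data for the concrete boundary system: the resolvent `R = (M - i)⁻¹` of a self-adjoint
operator `M` in `𝓗`, the map `Γ = (M - i)⁻¹ K`, the space `X` of the vectors which represent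
bounded channel directions, and auxiliary inverses `b`, `b'` of unbounded self-adjoint operators
together with isometries `κ`, `κ'` transversal to the domains of these. -/
structure Model (𝓗 E G G' : Type*) [NormedAddCommGroup 𝓗] [InnerProductSpace ℂ 𝓗]
    [NormedAddCommGroup E] [InnerProductSpace ℂ E] [CompleteSpace 𝓗] [CompleteSpace E]
    [NormedAddCommGroup G] [InnerProductSpace ℂ G] [CompleteSpace G]
    [NormedAddCommGroup G'] [InnerProductSpace ℂ G'] [CompleteSpace G']
    (X : Submodule ℂ 𝓗) [X.HasOrthogonalProjection] [CompleteSpace X] where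
  R : 𝓗 →L[ℂ] 𝓗
  Γ : E →L[ℂ] 𝓗
  Q : E →L[ℂ] E
  κ : X →L[ℂ] G
  b : G →L[ℂ] G
  κ' : E →L[ℂ] G'
  b' : G' →L[ℂ] G'
  Q_symm : ∀ x y, inner ℂ (Q x) y = inner ℂ x (Q y)
  R_symm : ∀ x y, inner ℂ (R x) y - inner ℂ x (R y) + 2 * I * inner ℂ (R x) (R y) = 0
  R_surj : ∀ z : ℂ, z.im ≠ 0 → ∀ q, ∃ p, p + (I - z) • R p = q
  mem_X : ∀ x, x ∈ X ↔ ∃ e, R x = Γ e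
  κ_isom : ∀ x y, inner ℂ (κ x) (κ y) = inner ℂ x y
  b_symm : ∀ x y, inner ℂ (b x) y = inner ℂ x (b y)
  b_inj : ∀ x y, b x = κ y → x = 0 ∧ y = 0
  κ'_isom : ∀ x y, inner ℂ (κ' x) (κ' y) = inner ℂ x y
  b'_symm : ∀ x y, inner ℂ (b' x) y = inner ℂ x (b' y)
  b'_inj : ∀ x y, b' x = κ' y → x = 0 ∧ y = 0

namespace Model

variable {𝓗 E G G' : Type*} [NormedAddCommGroup 𝓗] [InnerProductSpace ℂ 𝓗]
    [NormedAddCommGroup E] [InnerProductSpace ℂ E] [CompleteSpace 𝓗] [CompleteSpace E]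
    [NormedAddCommGroup G] [InnerProductSpace ℂ G] [CompleteSpace G]
    [NormedAddCommGroup G'] [InnerProductSpace ℂ G'] [CompleteSpace G']
    {X : Submodule ℂ 𝓗} [X.HasOrthogonalProjection] [CompleteSpace X]
    (M : Model 𝓗 E G G' X)

open ContinuousLinearMap (adjoint)

/-- The directions which the channel does not connect to the state space. -/
abbrev N : Submodule ℂ E := LinearMap.ker (M.Γ : E →ₗ[ℂ] 𝓗)

theorem isClosed_N : IsClosed (M.N : Set E) := M.Γ.isClosed_ker

instance : M.N.HasOrthogonalProjection :=
  haveI : CompleteSpace M.N := M.isClosed_N.completeSpace_coe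
  inferInstance

theorem adjoint_κ_κ (x : X) : adjoint M.κ (M.κ x) = x :=
  ext_inner_left ℂ fun y => by rw [ContinuousLinearMap.adjoint_inner_right, M.κ_isom]

theorem adjoint_κ'_κ' (x : E) : adjoint M.κ' (M.κ' x) = x :=
  ext_inner_left ℂ fun y => by rw [ContinuousLinearMap.adjoint_inner_right, M.κ'_isom]

theorem inner_eq_add (x y : 𝓗) :
    inner ℂ x y = inner ℂ (Xᗮ.orthogonalProjectionOnto x) (Xᗮ.orthogonalProjectionOnto y) +
      inner ℂ (X.orthogonalProjectionOnto x) (X.orthogonalProjectionOnto y) := by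
  rw [Submodule.inner_orthogonalProjectionOnto_eq_of_mem_left,
    Submodule.inner_orthogonalProjectionOnto_eq_of_mem_left, ← inner_add_left,
    ← Submodule.starProjection_apply, ← Submodule.starProjection_apply, add_comm,
    Submodule.starProjection_add_starProjection_orthogonal]

/-- The space of all parameters `(p, e, φ, ψ, η)`. -/
abbrev Par (_ : Model 𝓗 E G G' X) : Type _ := 𝓗 × E × G × G × G'

/-- The component `R p + Γ e` in the domain of the maximal operator. -/
def f : M.Par →ₗ[ℂ] 𝓗 :=
  M.R ∘ₗ LinearMap.fst ℂ _ _ + M.Γ ∘ₗ LinearMap.fst ℂ _ _ ∘ₗ LinearMap.snd ℂ _ _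

theorem f_apply (p : 𝓗) (e : E) (φ ψ : G) (η : G') : M.f (p, e, φ, ψ, η) = M.R p + M.Γ e := rfl

/-- The image `p + i f` of `f` under the maximal operator. -/
def m : M.Par →ₗ[ℂ] 𝓗 := LinearMap.fst ℂ _ _ + I • M.f

theorem m_apply (v : M.Par) : M.m v = v.1 + I • M.f v := rfl

/-- The coupling condition between the two parts of the state space. -/
def coupling : M.Par →ₗ[ℂ] X :=
  (adjoint M.κ : G →ₗ[ℂ] X) ∘ₗ LinearMap.fst ℂ _ _ ∘ₗ LinearMap.snd ℂ _ _ ∘ₗ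
    LinearMap.snd ℂ _ _ ∘ₗ LinearMap.snd ℂ _ _ -
  (X.orthogonalProjectionOnto : 𝓗 →ₗ[ℂ] X) ∘ₗ M.m

theorem coupling_apply (v : M.Par) :
    M.coupling v = adjoint M.κ v.2.2.2.1 - X.orthogonalProjectionOnto (M.m v) := rfl

/-- The admissible parameters. -/
abbrev Adm : Submodule ℂ M.Par := LinearMap.ker M.coupling

theorem mem_Adm {v : M.Par} :
    v ∈ M.Adm ↔ adjoint M.κ v.2.2.2.1 = X.orthogonalProjectionOnto (M.m v) := by
  rw [LinearMap.mem_ker, coupling_apply, sub_eq_zero]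

/-- The state space. -/
abbrev State (_ : Model 𝓗 E G G' X) : Type _ := WithLp 2 (WithLp 2 (Xᗮ × G) × WithLp 2 (G × G'))

/-- The state of a parameter. -/
def st : M.Par →ₗ[ℂ] M.State where
  toFun v := WithLp.toLp 2
    (WithLp.toLp 2 (Xᗮ.orthogonalProjectionOnto (M.f v),
      M.b v.2.2.1 + M.κ (X.orthogonalProjectionOnto (M.f v))),
    WithLp.toLp 2 (M.b v.2.2.2.1, M.b' v.2.2.2.2 + M.κ' (M.N.starProjection v.2.1)))
  map_add' v w := by
    simp only [map_add, Prod.fst_add, Prod.snd_add, ← WithLp.toLp_add, Prod.mk_add_mk]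
    simp only [add_add_add_comm]
  map_smul' c v := by
    simp only [map_smul, Prod.smul_fst, Prod.smul_snd, ← WithLp.toLp_smul, Prod.smul_mk,
      RingHom.id_apply, smul_add]

theorem st_apply (v : M.Par) : M.st v = WithLp.toLp 2
    (WithLp.toLp 2 (Xᗮ.orthogonalProjectionOnto (M.f v),
      M.b v.2.2.1 + M.κ (X.orthogonalProjectionOnto (M.f v))),
    WithLp.toLp 2 (M.b v.2.2.2.1, M.b' v.2.2.2.2 + M.κ' (M.N.starProjection v.2.1))) := rfl

/-- The image of the state under the maximal operator. -/
def im : M.Par →ₗ[ℂ] M.State where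
  toFun v := WithLp.toLp 2
    (WithLp.toLp 2 (Xᗮ.orthogonalProjectionOnto (M.m v), v.2.2.2.1),
    WithLp.toLp 2 (v.2.2.1, v.2.2.2.2))
  map_add' v w := by
    simp only [map_add, Prod.fst_add, Prod.snd_add, ← WithLp.toLp_add, Prod.mk_add_mk]
  map_smul' c v := by
    simp only [map_smul, Prod.smul_fst, Prod.smul_snd, ← WithLp.toLp_smul, Prod.smul_mk,
      RingHom.id_apply]

theorem im_apply (v : M.Par) : M.im v = WithLp.toLp 2
    (WithLp.toLp 2 (Xᗮ.orthogonalProjectionOnto (M.m v), v.2.2.2.1),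
    WithLp.toLp 2 (v.2.2.1, v.2.2.2.2)) := rfl

/-- The first boundary map. -/
def Γ₀ : M.Par →ₗ[ℂ] E := LinearMap.fst ℂ _ _ ∘ₗ LinearMap.snd ℂ _ _

/-- The second boundary map. -/
def Γ₁ : M.Par →ₗ[ℂ] E where
  toFun v := adjoint M.Γ (v.1 + (2 * I) • M.R v.1 + I • M.Γ v.2.1) + M.Q v.2.1 +
    M.N.starProjection (adjoint M.κ' v.2.2.2.2)
  map_add' v w := by
    simp only [map_add, Prod.fst_add, Prod.snd_add, smul_add]
    abel
  map_smul' c v := by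
    simp only [map_add, map_smul, Prod.smul_fst, Prod.smul_snd, RingHom.id_apply, smul_add,
      smul_comm c]

theorem Γ₁_apply (v : M.Par) : M.Γ₁ v =
    adjoint M.Γ (v.1 + (2 * I) • M.R v.1 + I • M.Γ v.2.1) + M.Q v.2.1 +
      M.N.starProjection (adjoint M.κ' v.2.2.2.2) := rfl

/-- Transversality gives `φ = ψ = η = 0`, `P_X f = 0` and `P_N e = 0`, so `f = 0`. Then `R p = -Γ e`
puts `p` in `X`, while the coupling condition says `P_X p = 0`; hence `p = 0`, and `e` lies in `N`
with `P_N e = 0`. -/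
theorem st_injective {v : M.Par} (hv : v ∈ M.Adm) (h : M.st v = 0) : v = 0 := by
  obtain ⟨p, e, φ, ψ, η⟩ := v
  rw [mem_Adm, m_apply] at hv
  rw [st_apply] at h
  have h1 := congrArg (fun x : M.State => x.fst.fst) h
  have h2 := congrArg (fun x : M.State => x.fst.snd) h
  have h3 := congrArg (fun x : M.State => x.snd.fst) h
  have h4 := congrArg (fun x : M.State => x.snd.snd) h
  change Xᗮ.orthogonalProjectionOnto (M.f (p, e, φ, ψ, η)) = 0 at h1
  change M.b φ + M.κ (X.orthogonalProjectionOnto (M.f (p, e, φ, ψ, η))) = 0 at h2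
  change M.b ψ = 0 at h3
  change M.b' η + M.κ' (M.N.starProjection e) = 0 at h4
  dsimp only at hv
  obtain ⟨hφ, hPf⟩ := M.b_inj φ (-(X.orthogonalProjectionOnto (M.f (p, e, φ, ψ, η))))
    (by rw [map_neg]; exact eq_neg_of_add_eq_zero_left h2)
  rw [neg_eq_zero] at hPf
  obtain ⟨hη, he⟩ := M.b'_inj η (-(M.N.starProjection e))
    (by rw [map_neg]; exact eq_neg_of_add_eq_zero_left h4)
  rw [neg_eq_zero] at he
  have hψ : ψ = 0 := (M.b_inj ψ 0 (by rw [h3, map_zero])).1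
  have hf : M.f (p, e, φ, ψ, η) = 0 := by
    rw [← Submodule.starProjection_add_starProjection_orthogonal (K := X) (M.f (p, e, φ, ψ, η)),
      Submodule.starProjection_apply, Submodule.starProjection_apply, hPf, h1]
    simp
  rw [hf, hψ, map_zero, smul_zero, add_zero] at hv
  have hp : p = 0 := by
    have hpX : p ∈ X := (M.mem_X p).2 ⟨-e, by
      rw [f_apply] at hf; rw [map_neg]; exact eq_neg_of_add_eq_zero_left hf⟩
    have := Submodule.orthogonalProjectionOnto_mem_subspace_eq_self (⟨p, hpX⟩ : X)
    rw [← hv] at this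
    exact (congrArg Subtype.val this).symm
  have heN : e ∈ M.N := by
    rw [f_apply, hp, map_zero, zero_add] at hf
    exact hf
  rw [Submodule.starProjection_eq_self_iff.2 heN] at he
  rw [hp, he, hφ, hψ, hη]; rfl

/-- Here `p + 2i R p` plays the role of `(M + i) R p` for the self-adjoint operator with resolvent
`R` at `i`. The identity reduces to the resolvent identity `R_symm`. -/
theorem green_max (v w : M.Par) :
    inner ℂ (M.f v) (M.m w) - inner ℂ (M.m v) (M.f w) =
      inner ℂ v.2.1 (adjoint M.Γ (w.1 + (2 * I) • M.R w.1 + I • M.Γ w.2.1)) -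
      inner ℂ (adjoint M.Γ (v.1 + (2 * I) • M.R v.1 + I • M.Γ v.2.1)) w.2.1 := by
  obtain ⟨p, e, φ, ψ, η⟩ := v
  obtain ⟨p', e', φ', ψ', η'⟩ := w
  rw [ContinuousLinearMap.adjoint_inner_right, ContinuousLinearMap.adjoint_inner_left]
  simp only [m_apply, f_apply, inner_add_left, inner_add_right, inner_smul_left, inner_smul_right,
    map_mul, conj_I, map_ofNat]
  linear_combination M.R_symm p p'

/-- The `X`-part of the pairing is carried by `κ` and the coupling. The terms in `b` occur once with
`(φ, ψ)` and once with `(ψ, φ)`, and cancel since `b` is symmetric; `κ'` produces exactly the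
`N`-part of `Γ₁`. -/
theorem green {v w : M.Par} (hv : v ∈ M.Adm) (hw : w ∈ M.Adm) :
    inner ℂ (M.st v) (M.im w) - inner ℂ (M.im v) (M.st w) =
      inner ℂ (M.Γ₀ v) (M.Γ₁ w) - inner ℂ (M.Γ₁ v) (M.Γ₀ w) := by
  have h := M.green_max v w
  rw [inner_eq_add (X := X), inner_eq_add (X := X) (M.m v), ← M.mem_Adm.1 hv, ← M.mem_Adm.1 hw,
    ContinuousLinearMap.adjoint_inner_right, ContinuousLinearMap.adjoint_inner_left] at h
  have hN1 : inner ℂ v.2.1 (M.N.starProjection (adjoint M.κ' w.2.2.2.2)) =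
      inner ℂ (M.κ' (M.N.starProjection v.2.1)) w.2.2.2.2 := by
    rw [← Submodule.inner_starProjection_left_eq_right, ContinuousLinearMap.adjoint_inner_right]
  have hN2 : inner ℂ (M.N.starProjection (adjoint M.κ' v.2.2.2.2)) w.2.1 =
      inner ℂ v.2.2.2.2 (M.κ' (M.N.starProjection w.2.1)) := by
    rw [Submodule.inner_starProjection_left_eq_right, ContinuousLinearMap.adjoint_inner_left]
  rw [st_apply, st_apply, im_apply, im_apply, Γ₁_apply, Γ₁_apply]
  change _ = inner ℂ v.2.1 _ - inner ℂ _ w.2.1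
  simp only [WithLp.prod_inner_apply, inner_add_left, inner_add_right, hN1, hN2] at h ⊢
  linear_combination h + M.b_symm v.2.2.1 w.2.2.2.1 +
    M.b_symm v.2.2.2.1 w.2.2.1 + M.b'_symm v.2.2.2.2 w.2.2.2.2 + M.Q_symm v.2.1 w.2.1

end Model

/-! ### The model as a boundary system, and its solutions. -/

namespace Model

variable {𝓗 E G G' : Type*} [NormedAddCommGroup 𝓗] [InnerProductSpace ℂ 𝓗]
    [NormedAddCommGroup E] [InnerProductSpace ℂ E] [CompleteSpace 𝓗] [CompleteSpace E]
    [NormedAddCommGroup G] [InnerProductSpace ℂ G] [CompleteSpace G]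
    [NormedAddCommGroup G'] [InnerProductSpace ℂ G'] [CompleteSpace G']
    {X : Submodule ℂ 𝓗} [X.HasOrthogonalProjection] [CompleteSpace X]
    (M : Model 𝓗 E G G' X)

open ContinuousLinearMap (adjoint)

/-- The projection onto the first half of the state space. -/
def proj (_ : Model 𝓗 E G G' X) : WithLp 2 (WithLp 2 (Xᗮ × G) × WithLp 2 (G × G')) →L[ℂ]
    WithLp 2 (WithLp 2 (Xᗮ × G) × WithLp 2 (G × G')) := dsum 1 0

theorem proj_apply (x : WithLp 2 (Xᗮ × G)) (y : WithLp 2 (G × G')) :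
    M.proj (WithLp.toLp 2 (x, y)) = WithLp.toLp 2 (x, 0) := rfl

/-- The projection onto the first components of both halves of the state space. -/
def proj' (_ : Model 𝓗 E G G' X) : WithLp 2 (WithLp 2 (Xᗮ × G) × WithLp 2 (G × G')) →L[ℂ]
    WithLp 2 (WithLp 2 (Xᗮ × G) × WithLp 2 (G × G')) := dsum (dsum 1 0) (dsum 1 0)

theorem proj'_apply (x : Xᗮ) (x' y : G) (y' : G') :
    M.proj' (WithLp.toLp 2 (WithLp.toLp 2 (x, x'), WithLp.toLp 2 (y, y'))) =
      WithLp.toLp 2 (WithLp.toLp 2 (x, 0), WithLp.toLp 2 (y, 0)) := rfl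

theorem eq_of_orthogonalProjectionOnto {x y : 𝓗}
    (h₁ : Xᗮ.orthogonalProjectionOnto x = Xᗮ.orthogonalProjectionOnto y)
    (h₂ : X.orthogonalProjectionOnto x = X.orthogonalProjectionOnto y) : x = y := by
  rw [← Submodule.starProjection_add_starProjection_orthogonal (K := X) x,
    ← Submodule.starProjection_add_starProjection_orthogonal (K := X) y]
  simp only [Submodule.starProjection_apply, h₁, h₂]

theorem exists_f_eq (z : ℂ) (hz : z.im ≠ 0) (q : 𝓗) (e : E) :
    ∃ p, p + I • (M.R p + M.Γ e) - z • (M.R p + M.Γ e) = q := by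
  obtain ⟨p, hp⟩ := M.R_surj z hz (q - (I - z) • M.Γ e)
  refine ⟨p, ?_⟩
  rw [eq_sub_iff_add_eq] at hp
  rw [← hp]
  module

theorem solvable (z : ℂ) (hz : z.im ≠ 0) (h : M.State) (e : E) :
    ∃ v ∈ M.Adm, M.im v - z • M.proj (M.st v) = h ∧ M.Γ₀ v = e := by
  obtain ⟨⟨q₁, q₂⟩, ⟨φ, η⟩⟩ := h
  -- The `X`-component of `q` is dictated by the coupling once `m - z f = q` and `ψ = q₂ + z (b φ +
  -- κ P_X f)`; the components annihilated by `F` give `φ` and `η` directly.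
  set q : 𝓗 := q₁ + (adjoint M.κ q₂ : X) + z • ((adjoint M.κ (M.b φ) : X) : 𝓗) with hq
  have hq₁ : Xᗮ.orthogonalProjectionOnto q = q₁ := by
    rw [hq, map_add, map_add, map_smul, Submodule.orthogonalProjectionOnto_mem_subspace_eq_self,
      Submodule.orthogonalProjectionOnto_orthogonal_apply_eq_zero (Subtype.coe_prop _),
      Submodule.orthogonalProjectionOnto_orthogonal_apply_eq_zero (Subtype.coe_prop _)]
    simp
  have hq₂ : X.orthogonalProjectionOnto q = adjoint M.κ q₂ + z • adjoint M.κ (M.b φ) := by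
    rw [hq, map_add, map_add, map_smul,
      Submodule.orthogonalProjectionOnto_apply_of_mem_orthogonal (Subtype.coe_prop _),
      Submodule.orthogonalProjectionOnto_mem_subspace_eq_self,
      Submodule.orthogonalProjectionOnto_mem_subspace_eq_self, zero_add]
  obtain ⟨p, hp⟩ := M.exists_f_eq z hz q e
  set f : 𝓗 := M.R p + M.Γ e with hf
  refine ⟨(p, e, φ, q₂ + z • (M.b φ + M.κ (X.orthogonalProjectionOnto f)), η), ?_, ?_, rfl⟩
  · rw [M.mem_Adm, m_apply, f_apply, ← hf]
    have : p + I • f = q + z • f := sub_eq_iff_eq_add.1 hp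
    dsimp only
    rw [this, map_add, map_smul, map_add, M.adjoint_κ_κ, map_add _ q, map_smul, hq₂, smul_add,
      add_assoc]
  · rw [im_apply, st_apply, proj_apply, m_apply, f_apply, ← hf, ← WithLp.toLp_smul, Prod.smul_mk,
      ← WithLp.toLp_smul, Prod.smul_mk, ← WithLp.toLp_sub, Prod.mk_sub_mk, ← WithLp.toLp_sub,
      Prod.mk_sub_mk, smul_zero, sub_zero, ← map_smul, ← map_sub, hp, hq₁, add_sub_cancel_right]

/-- The coupling with `ψ = 0` requires `P_X m = 0`. Since `x = P_X m` satisfies `R x = Γ e'`,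
passing from `(p, e)` to `(p - x, e + e')` removes `x` from `m` without changing `f`. -/
theorem proj_reduces {v : M.Par} (hv : v ∈ M.Adm) :
    ∃ w ∈ M.Adm, M.st w = M.proj (M.st v) ∧ M.im w = M.proj' (M.im v) := by
  obtain ⟨p, e, φ, ψ, η⟩ := v
  set f : 𝓗 := M.R p + M.Γ e with hf
  set x : X := X.orthogonalProjectionOnto (p + I • f) with hx
  obtain ⟨e', he'⟩ := (M.mem_X x).1 x.2
  -- Subtracting the part in `N` does not affect `Γ` and makes the last state component vanish.
  set e'' : E := e + e' - M.N.starProjection (e + e') with he''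
  have hΓ : M.Γ (M.N.starProjection (e + e')) = 0 :=
    Submodule.starProjection_apply_mem M.N (e + e')
  have hf' : M.R (p - x) + M.Γ e'' = f := by
    rw [he'', map_sub, map_sub, map_add, he', hΓ, hf]
    abel
  have hm : p - x + I • f = p + I • f - x := by abel
  refine ⟨(p - x, e'', φ, 0, 0), ?_, ?_, ?_⟩
  · rw [M.mem_Adm, m_apply, f_apply, hf']
    dsimp only
    rw [hm, map_sub, ← hx, Submodule.orthogonalProjectionOnto_mem_subspace_eq_self, sub_self,
      map_zero]
  · have hN : M.N.starProjection e'' = 0 := by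
      rw [he'', map_sub, Submodule.starProjection_eq_self_iff.2
        (Submodule.starProjection_apply_mem M.N (e + e')), sub_self]
    rw [st_apply, st_apply, proj_apply, f_apply, f_apply, hf', ← hf]
    dsimp only
    rw [hN, map_zero, map_zero, map_zero, add_zero]
    rfl
  · rw [im_apply, im_apply, proj'_apply, m_apply, m_apply, f_apply, f_apply, hf', ← hf]
    dsimp only
    rw [hm, map_sub,
      Submodule.orthogonalProjectionOnto_orthogonal_apply_eq_zero (Subtype.coe_prop _), sub_zero]

theorem mem_range_adjoint [FiniteDimensional ℂ E] (y : E) :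
    ∃ g, adjoint M.Γ g = y - M.N.starProjection y := by
  have h : y - M.N.starProjection y ∈ M.Nᗮ := M.N.sub_starProjection_mem_orthogonal y
  rw [ContinuousLinearMap.orthogonal_ker,
    (Submodule.closed_of_finiteDimensional _).submodule_topologicalClosure_eq] at h
  exact h

theorem surjective_Γ₁ [FiniteDimensional ℂ E] (y : E) :
    ∃ v ∈ M.Adm, M.Γ₀ v = 0 ∧ M.Γ₁ v = y := by
  obtain ⟨g, hg⟩ := M.mem_range_adjoint y
  -- At `z = -i` the solvable equation is `p + 2i R p = g`, the expression under `Γ*` in `Γ₁`. It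
  -- covers the complement of `N`, and `η = κ' P_N y` covers `N`.
  obtain ⟨p, hp⟩ := M.R_surj (-I) (by simp) g
  refine ⟨(p, 0, 0, M.κ (X.orthogonalProjectionOnto (p + I • (M.R p + M.Γ 0))),
    M.κ' (M.N.starProjection y)), ?_, rfl, ?_⟩
  · rw [M.mem_Adm, m_apply, f_apply]
    exact M.adjoint_κ_κ _
  · rw [Γ₁_apply]
    dsimp only
    rw [M.adjoint_κ'_κ', map_zero, map_zero, smul_zero, add_zero, add_zero,
      show (2 * I) = I - -I by ring, hp, hg, Submodule.starProjection_eq_self_iff.2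
        (Submodule.starProjection_apply_mem M.N y), sub_add_cancel]

/-- The boundary system of the model. -/
def boundarySystem [FiniteDimensional ℂ E] : BoundarySystem M.Adm M.State E where
  ι := M.st ∘ₗ M.Adm.subtype
  L := M.im ∘ₗ M.Adm.subtype
  Γ₀ := M.Γ₀ ∘ₗ M.Adm.subtype
  Γ₁ := M.Γ₁ ∘ₗ M.Adm.subtype
  F := M.proj
  F' := M.proj'
  ι_inj := (injective_iff_map_eq_zero _).2 fun v h => Subtype.ext (M.st_injective v.2 h)
  green v w := M.green v.2 w.2
  F_proj := isSymmetricProjection_dsum_one_zero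
  F'_symm := isSymmetric_dsum isSymmetricProjection_dsum_one_zero.isSymmetric
    isSymmetricProjection_dsum_one_zero.isSymmetric
  solv z hz h e := by
    obtain ⟨v, hv, h⟩ := M.solvable z hz h e
    exact ⟨⟨v, hv⟩, h⟩
  surj y := by
    obtain ⟨v, hv, h⟩ := M.surjective_Γ₁ y
    exact ⟨⟨v, hv⟩, h⟩
  reduces v := by
    obtain ⟨w, hw, h⟩ := M.proj_reduces v.2
    exact ⟨⟨w, hw⟩, h⟩

/-- The boundary values of the solutions of the homogeneous equation of the pencil. -/
theorem Γ₁_eq_of_im_eq {v : M.Par} (hv : v ∈ M.Adm) {z : ℂ} (h : M.im v = z • M.proj (M.st v)) :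
    v.1 + (I - z) • M.R v.1 = (z - I) • M.Γ (M.Γ₀ v) ∧
      M.Γ₁ v = adjoint M.Γ (v.1 + (2 * I) • M.R v.1 + I • M.Γ (M.Γ₀ v)) + M.Q (M.Γ₀ v) := by
  obtain ⟨p, e, φ, ψ, η⟩ := v
  rw [mem_Adm, m_apply, f_apply] at hv
  rw [im_apply, st_apply, proj_apply, m_apply, f_apply] at h
  have h1 := congrArg (fun x : M.State => x.fst.fst) h
  have h2 := congrArg (fun x : M.State => x.fst.snd) h
  have h3 := congrArg (fun x : M.State => x.snd.fst) h
  have h4 := congrArg (fun x : M.State => x.snd.snd) h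
  change Xᗮ.orthogonalProjectionOnto (p + I • (M.R p + M.Γ e)) =
    z • Xᗮ.orthogonalProjectionOnto (M.R p + M.Γ e) at h1
  change ψ = z • (M.b φ + M.κ (X.orthogonalProjectionOnto (M.R p + M.Γ e))) at h2
  change φ = z • (0 : G) at h3
  change η = z • (0 : G') at h4
  rw [smul_zero] at h3 h4
  subst h3 h4
  dsimp only at hv
  rw [h2, map_zero, zero_add, map_smul, M.adjoint_κ_κ] at hv
  have hm : p + I • (M.R p + M.Γ e) = z • (M.R p + M.Γ e) :=
    eq_of_orthogonalProjectionOnto (X := X) (by rw [h1, map_smul]) (by rw [← hv, map_smul])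
  constructor
  · change p + (I - z) • M.R p = (z - I) • M.Γ e
    rw [← sub_eq_zero] at hm ⊢
    rw [← hm]
    module
  · rw [Γ₁_apply]
    dsimp only
    rw [map_zero, map_zero, add_zero]
    rfl

end Model

/-! ### Multiplication operators in `L²`. -/

section Multiplication

open scoped ENNReal

variable {α Y : Type*} [MeasurableSpace α] {μ : Measure α}
    [NormedAddCommGroup Y] [InnerProductSpace ℂ Y]

/-- Multiplication by an essentially bounded operator function. -/
def mulOp (h : α → Y →L[ℂ] Y) (hh : MemLp h ∞ μ) : Lp Y 2 μ →L[ℂ] Lp Y 2 μ :=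
  (ContinuousLinearMap.id ℂ (Y →L[ℂ] Y)).holderL μ ∞ 2 2 hh.toLp

theorem coeFn_mulOp (h : α → Y →L[ℂ] Y) (hh : MemLp h ∞ μ) (f : Lp Y 2 μ) :
    mulOp h hh f =ᵐ[μ] fun t => h t (f t) := by
  filter_upwards [(ContinuousLinearMap.id ℂ (Y →L[ℂ] Y)).coeFn_holder (r := 2) hh.toLp f,
    hh.coeFn_toLp] with t h₁ h₂
  rw [mulOp, ContinuousLinearMap.holderL_apply_apply, h₁, h₂]
  rfl

/-- Multiplication by an essentially bounded scalar function. -/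
def smulOp (Y : Type*) [NormedAddCommGroup Y] [InnerProductSpace ℂ Y] (c : α → ℂ)
    (hc : MemLp c ∞ μ) : Lp Y 2 μ →L[ℂ] Lp Y 2 μ :=
  (ContinuousLinearMap.lsmul ℂ ℂ : ℂ →L[ℂ] Y →L[ℂ] Y).holderL μ ∞ 2 2 hc.toLp

theorem coeFn_smulOp (c : α → ℂ) (hc : MemLp c ∞ μ) (f : Lp Y 2 μ) :
    smulOp Y c hc f =ᵐ[μ] fun t => c t • f t := by
  filter_upwards [(ContinuousLinearMap.lsmul ℂ ℂ : ℂ →L[ℂ] Y →L[ℂ] Y).coeFn_holder (r := 2)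
    hc.toLp f, hc.coeFn_toLp] with t h₁ h₂
  rw [smulOp, ContinuousLinearMap.holderL_apply_apply, h₁, h₂]
  rfl

theorem inner_smulOp_left (c : α → ℂ) (hc : MemLp c ∞ μ) (f g : Lp Y 2 μ) :
    inner ℂ (smulOp Y c hc f) g = ∫ t, conj (c t) * inner ℂ (f t) (g t) ∂μ := by
  rw [L2.inner_def]
  refine integral_congr_ae ?_
  filter_upwards [coeFn_smulOp c hc f] with t h
  rw [h, inner_smul_left]

theorem inner_smulOp_right (c : α → ℂ) (hc : MemLp c ∞ μ) (f g : Lp Y 2 μ) :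
    inner ℂ f (smulOp Y c hc g) = ∫ t, c t * inner ℂ (f t) (g t) ∂μ := by
  rw [L2.inner_def]
  refine integral_congr_ae ?_
  filter_upwards [coeFn_smulOp c hc g] with t h
  rw [h, inner_smul_right]

end Multiplication

/-! ### Transversal operator ranges. -/

section Directions

open scoped ENNReal

/-- Every Hilbert space embeds isometrically into a Hilbert space with a bounded self-adjoint
injective operator whose range meets the image only in zero. -/
theorem exists_transversal (Y : Type u) [NormedAddCommGroup Y] [InnerProductSpace ℂ Y]
    [CompleteSpace Y] :
    ∃ (G : Type u) (_ : NormedAddCommGroup G) (_ : InnerProductSpace ℂ G) (_ : CompleteSpace G)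
      (κ : Y →L[ℂ] G) (b : G →L[ℂ] G),
      (∀ x y, inner ℂ (κ x) (κ y) = inner ℂ x y) ∧
      (∀ x y, inner ℂ (b x) y = inner ℂ x (b y)) ∧
      ∀ x y, b x = κ y → x = 0 ∧ y = 0 := by
  set ν : Measure ℝ := volume.restrict (Set.Ioc 0 1) with hν
  have : IsProbabilityMeasure ν := ⟨by simp [hν]⟩
  have hc : MemLp (fun t : ℝ => (t : ℂ)) ∞ ν := by
    refine memLp_top_of_bound (by fun_prop) 1 ?_
    filter_upwards [ae_restrict_mem measurableSet_Ioc] with t ht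
    rw [norm_real, Real.norm_of_nonneg ht.1.le]
    exact ht.2
  -- Take `L²((0, 1]; Y)` with `κ` the constants and `b` multiplication by `t`. Then `b f = κ y`
  -- means `f = y / t`, which is not integrable unless `y = 0`.
  refine ⟨Lp Y 2 ν, inferInstance, inferInstance, inferInstance, Lp.constL 2 ν ℂ,
    smulOp Y _ hc, fun x y => ?_, fun x y => ?_, fun f y h => ?_⟩
  · rw [L2.inner_def]
    have : ∀ᵐ t ∂ν, inner ℂ (Lp.constL 2 ν ℂ x t) (Lp.constL 2 ν ℂ y t) = inner ℂ x y := by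
      filter_upwards [Lp.coeFn_const 2 ν x, Lp.coeFn_const 2 ν y] with t h₁ h₂
      change inner ℂ (Lp.const 2 ν x t) (Lp.const 2 ν y t) = _
      rw [h₁, h₂]
      rfl
    rw [integral_congr_ae this]
    simp
  · rw [inner_smulOp_left, inner_smulOp_right]
    simp only [conj_ofReal]
  · have hae : ∀ᵐ t : ℝ ∂ν, (t : ℂ) • f t = y := by
      have h₂ := Lp.coeFn_const 2 ν y
      have h₁ := coeFn_smulOp _ hc f
      rw [h] at h₁
      filter_upwards [h₁, h₂] with t h₁ h₂
      rw [← h₁]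
      exact h₂
    have hy : y = 0 := by
      by_contra hy
      have hint : Integrable f ν :=
        (Lp.memLp f).integrable (by norm_num)
      have hinv : Integrable (fun t : ℝ => t⁻¹) ν := by
        refine (hint.norm.const_mul ‖y‖⁻¹).congr ?_
        filter_upwards [hae, ae_restrict_mem measurableSet_Ioc] with t ht ht'
        rw [← ht, norm_smul, norm_real, Real.norm_of_nonneg ht'.1.le, mul_inv, mul_assoc,
          inv_mul_cancel₀, mul_one]
        rw [norm_ne_zero_iff]
        rintro h0
        rw [h0, smul_zero] at ht
        exact hy ht.symm
      have : IntervalIntegrable (fun t : ℝ => t⁻¹) volume 0 1 :=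
        (intervalIntegrable_iff_integrableOn_Ioc_of_le zero_le_one).2 hinv
      rw [intervalIntegrable_inv_iff] at this
      simp at this
    refine ⟨?_, hy⟩
    rw [Lp.eq_zero_iff_ae_eq_zero]
    filter_upwards [hae, ae_restrict_mem measurableSet_Ioc] with t ht ht'
    rw [hy, smul_eq_zero, ofReal_eq_zero] at ht
    exact ht.resolve_left ht'.1.ne'

end Directions

/-! ### Reduction of quadratic forms to finitely many vectors. -/

section Frame

variable {E : Type*} [NormedAddCommGroup E] [InnerProductSpace ℂ E]

open ContinuousLinearMap (adjoint)

theorem polarization_sum {T : E →L[ℂ] E} (hT : (T : E →ₗ[ℂ] E).IsSymmetric) (x y : E) :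
    inner ℂ x (T y) = ∑ m : Fin 4, (![1, -1, I, -I] m / 4) *
      inner ℂ (y + (![1, -1, I, -I] m : ℂ) • x) (T (y + (![1, -1, I, -I] m : ℂ) • x)) := by
  have h := inner_map_polarization (T : E →ₗ[ℂ] E) y x
  rw [hT x y, hT, hT, hT, hT] at h
  simp only [ContinuousLinearMap.coe_coe] at h
  rw [h, Fin.sum_univ_four]
  simp only [Matrix.cons_val, one_smul, neg_smul, ← sub_eq_add_neg]
  ring

theorem inner_eq_ofReal_re {T : E →L[ℂ] E} (hT : (T : E →ₗ[ℂ] E).IsSymmetric) (x : E) :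
    inner ℂ x (T x) = ((inner ℂ x (T x)).re : ℂ) := by
  have h := hT x x
  rw [ContinuousLinearMap.coe_coe, ← inner_conj_symm] at h
  exact (conj_eq_iff_re.1 h).symm

/-- The quadratic forms of symmetric operators are combinations of finitely many of their values. -/
theorem exists_frame (E : Type*) [NormedAddCommGroup E] [InnerProductSpace ℂ E]
    [FiniteDimensional ℂ E] :
    ∃ (n : ℕ) (u : Fin n × Fin n × Fin 4 → E) (C : Fin n × Fin n × Fin 4 → E →L[ℂ] E),
      (∀ i, (C i : E →ₗ[ℂ] E).IsSymmetric) ∧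
      ∀ T : E →L[ℂ] E, (T : E →ₗ[ℂ] E).IsSymmetric → ∀ x,
        (inner ℂ x (T x)).re =
          ∑ i, (inner ℂ x (C i x)).re * (inner ℂ (u i) (T (u i))).re := by
  have : CompleteSpace E := FiniteDimensional.complete ℂ E
  let e := stdOrthonormalBasis ℂ E
  -- Expanding `(x, T x)` in the basis and polarizing each matrix entry gives rank-one coefficients;
  -- their Hermitian parts have the same real form.
  let D : Fin (Module.finrank ℂ E) × Fin (Module.finrank ℂ E) × Fin 4 → E →L[ℂ] E := fun i =>
    ((![1, -1, I, -I] i.2.2 : ℂ) / 4) • InnerProductSpace.rankOne ℂ (e i.1) (e i.2.1)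
  have hC : ∀ i x y, inner ℂ x (((1 / 2 : ℂ) • (D i + adjoint (D i))) y) =
      1 / 2 * (inner ℂ x (D i y) + inner ℂ (D i x) y) := fun i x y => by
    rw [smul_apply, inner_smul_right, add_apply, inner_add_right,
      ContinuousLinearMap.adjoint_inner_right]
  refine ⟨Module.finrank ℂ E, fun i => e i.2.1 + (![1, -1, I, -I] i.2.2 : ℂ) • e i.1,
    fun i => (1 / 2 : ℂ) • (D i + adjoint (D i)), fun i x y => ?_, fun T hT x => ?_⟩
  · simp only [ContinuousLinearMap.coe_coe]
    rw [← inner_conj_symm, hC, hC, map_mul, map_add, inner_conj_symm, inner_conj_symm]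
    simp only [map_div₀, map_one, map_ofNat, add_comm]
  · have hre : ∀ i, (inner ℂ x (((1 / 2 : ℂ) • (D i + adjoint (D i))) x)).re =
        (inner ℂ x (D i x)).re := fun i => by
      rw [hC, ← inner_conj_symm (D i x) x, add_conj]
      simp
    have hsum : inner ℂ x (T x) = ∑ i, inner ℂ x (D i x) *
        inner ℂ (e i.2.1 + (![1, -1, I, -I] i.2.2 : ℂ) • e i.1)
          (T (e i.2.1 + (![1, -1, I, -I] i.2.2 : ℂ) • e i.1)) := by
      rw [Fintype.sum_prod_type]
      simp only [Fintype.sum_prod_type]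
      have hx : T x = ∑ k, inner ℂ (e k) x • T (e k) := by
        conv_lhs => rw [← e.sum_repr' x]
        rw [map_sum]
        simp only [map_smul]
      rw [← e.sum_inner_mul_inner]
      refine Finset.sum_congr rfl fun j _ => ?_
      rw [hx, inner_sum, Finset.mul_sum]
      refine Finset.sum_congr rfl fun k _ => ?_
      rw [inner_smul_right, polarization_sum hT, Finset.mul_sum, Finset.mul_sum]
      refine Finset.sum_congr rfl fun m _ => ?_
      simp only [D, smul_apply, inner_smul_right, InnerProductSpace.rankOne_apply]
      ring
    rw [hsum, re_sum]
    refine Finset.sum_congr rfl fun i _ => ?_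
    rw [hre, inner_eq_ofReal_re hT, re_mul_ofReal]
    rfl

end Frame

/-! ### Radon-Nikodym density of the operator measure. -/

section Density

open scoped ENNReal

variable {E : Type*} [NormedAddCommGroup E] [InnerProductSpace ℂ E] {S : ℝ → E →L[ℂ] E}

theorem isSymmetric_sub_of_monotone (hS : Monotone S) (s t : ℝ) :
    ((S s - S t : E →L[ℂ] E) : E →ₗ[ℂ] E).IsSymmetric := by
  rcases le_total t s with h | h
  · exact (hS h).isSymmetric
  · rw [← neg_sub]
    intro x y
    have := (hS h).isSymmetric x y
    simp only [ContinuousLinearMap.coe_coe, neg_apply, inner_neg_left, inner_neg_right] at this ⊢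
    rw [this]

/-- The quadratic forms of symmetric operators at `x` are combinations of those at `u i`, with
coefficients `c i`. -/
def IsFrameAt {ι : Type*} [Fintype ι] (u : ι → E) (c : ι → ℝ) (x : E) : Prop :=
  ∀ T : E →L[ℂ] E, (T : E →ₗ[ℂ] E).IsSymmetric →
    (inner ℂ x (T x)).re = ∑ i, c i * (inner ℂ (u i) (T (u i))).re

variable {ι : Type*} [Fintype ι] {u : ι → E} {c : ι → ℝ} {x : E}

/-- Monotonicity makes only differences of `S` symmetric, so the frame identity applies to
increments; it passes to right limits. -/
theorem IsFrameAt.stieltjesFunction_sub (h : IsFrameAt u c x) (hS : Monotone S) (a b : ℝ) :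
    (monotone_form hS x).stieltjesFunction b - (monotone_form hS x).stieltjesFunction a =
      ∑ i, c i * ((monotone_form hS (u i)).stieltjesFunction b -
        (monotone_form hS (u i)).stieltjesFunction a) := by
  have key : ∀ s t, (inner ℂ x (S s x)).re - (inner ℂ x (S t x)).re =
      ∑ i, c i * ((inner ℂ (u i) (S s (u i))).re - (inner ℂ (u i) (S t (u i))).re) := fun s t => by
    have := h _ (isSymmetric_sub_of_monotone hS s t)
    simpa only [sub_apply, inner_sub_right, sub_re] using this
  have lim : ∀ r, (monotone_form hS x).stieltjesFunction r - (inner ℂ x (S 0 x)).re =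
      ∑ i, c i * ((monotone_form hS (u i)).stieltjesFunction r -
        (inner ℂ (u i) (S 0 (u i))).re) := fun r => by
    simp only [Monotone.stieltjesFunction_eq]
    refine tendsto_nhds_unique (((monotone_form hS x).tendsto_rightLim r).sub_const _) ?_
    simp only [key]
    exact tendsto_finsetSum _ fun i _ =>
      (((monotone_form hS (u i)).tendsto_rightLim r).sub_const _).const_mul _
  have := congrArg₂ (· - ·) (lim b) (lim a)
  simp only [← Finset.sum_sub_distrib, ← mul_sub, sub_sub_sub_cancel_right] at this
  exact this

/-- The coefficients may be negative, so their negative parts are moved to the other side to obtain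
an identity of positive measures, checked on half-open intervals. -/
theorem IsFrameAt.formMeasure_add (h : IsFrameAt u c x) (hS : Monotone S) :
    formMeasure S hS x + ∑ i, (-c i).toNNReal • formMeasure S hS (u i) =
      ∑ i, (c i).toNNReal • formMeasure S hS (u i) := by
  have hm : ∀ (y : E) {a b : ℝ}, a ≤ b → 0 ≤ (monotone_form hS y).stieltjesFunction b -
      (monotone_form hS y).stieltjesFunction a := fun y a b hab =>
    sub_nonneg.2 ((monotone_form hS y).stieltjesFunction.mono hab)
  have hIoc : ∀ (d : ι → NNReal) (a b : ℝ), a < b →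
      (∑ i, d i • formMeasure S hS (u i)) (Set.Ioc a b) =
      ENNReal.ofReal (∑ i, d i * ((monotone_form hS (u i)).stieltjesFunction b -
        (monotone_form hS (u i)).stieltjesFunction a)) := fun d a b hab => by
    rw [ENNReal.ofReal_sum_of_nonneg fun i _ => mul_nonneg (NNReal.coe_nonneg _) (hm (u i) hab.le),
      Measure.finsetSum_apply]
    refine Finset.sum_congr rfl fun i _ => ?_
    rw [ENNReal.ofReal_mul (NNReal.coe_nonneg _), Measure.smul_apply, formMeasure,
      StieltjesFunction.measure_Ioc, ENNReal.smul_def, smul_eq_mul, ENNReal.ofReal_coe_nnreal]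
  refine Measure.ext_of_Ioc' _ _ (fun a b hab => ?_) fun a b hab => ?_
  · rw [Measure.add_apply, hIoc _ _ _ hab, formMeasure, StieltjesFunction.measure_Ioc]
    finiteness
  · rw [Measure.add_apply, hIoc _ _ _ hab, hIoc _ _ _ hab, formMeasure,
      StieltjesFunction.measure_Ioc, ← ENNReal.ofReal_add (hm _ hab.le)
        (Finset.sum_nonneg fun i _ => mul_nonneg (NNReal.coe_nonneg _) (hm _ hab.le)),
      h.stieltjesFunction_sub hS, ← Finset.sum_add_distrib]
    congr 1
    refine Finset.sum_congr rfl fun i _ => ?_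
    rw [← add_mul, Real.coe_toNNReal', Real.coe_toNNReal']
    congr 1
    rcases le_total 0 (c i) with hc | hc
    · rw [max_eq_left hc, max_eq_right (neg_nonpos.2 hc), add_zero]
    · rw [max_eq_right hc, max_eq_left (neg_nonneg.2 hc), add_neg_cancel]

theorem IsFrameAt.integral_formMeasure (h : IsFrameAt u c x) (hS : Monotone S)
    {F : Type*} [NormedAddCommGroup F] [NormedSpace ℝ F] {g : ℝ → F}
    (hg : ∀ y, Integrable g (formMeasure S hS y)) :
    ∫ t, g t ∂(formMeasure S hS x) = ∑ i, c i • ∫ t, g t ∂(formMeasure S hS (u i)) := by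
  have hi : ∀ d : ι → NNReal, ∀ i ∈ Finset.univ, Integrable g (d i • formMeasure S hS (u i)) :=
    fun d i _ => (hg _).smul_measure_nnreal
  have key := congrArg (fun ν => ∫ t, g t ∂ν) (h.formMeasure_add hS)
  rw [integral_add_measure (hg x) (integrable_finsetSum_measure.2 (hi _)),
    integral_finsetSum_measure (hi _), integral_finsetSum_measure (hi _),
    ← eq_sub_iff_add_eq, ← Finset.sum_sub_distrib] at key
  rw [key]
  refine Finset.sum_congr rfl fun i _ => ?_
  rw [integral_smul_nnreal_measure, integral_smul_nnreal_measure, NNReal.smul_def, NNReal.smul_def,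
    ← sub_smul, Real.coe_toNNReal', Real.coe_toNNReal']
  congr 1
  rcases le_total 0 (c i) with hc | hc
  · rw [max_eq_left hc, max_eq_right (neg_nonpos.2 hc), sub_zero]
  · rw [max_eq_right hc, max_eq_left (neg_nonneg.2 hc), zero_sub, neg_neg]

/-- The finite measure `(dS(t) x, x) / (1 + t²)`. -/
def nevanlinnaMeasure (S : ℝ → E →L[ℂ] E) (hS : Monotone S) (x : E) : Measure ℝ :=
  (formMeasure S hS x).withDensity fun t => ENNReal.ofReal (1 / (1 + t ^ 2))

theorem isFiniteMeasure_nevanlinnaMeasure (hS : Monotone S)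
    (hfin : HasFiniteNevanlinnaIntegral S hS) (x : E) :
    IsFiniteMeasure (nevanlinnaMeasure S hS x) :=
  isFiniteMeasure_withDensity_ofReal (hfin x).2

theorem integral_nevanlinnaMeasure (hS : Monotone S) {F : Type*} [NormedAddCommGroup F]
    [NormedSpace ℝ F] (g : ℝ → F) (x : E) :
    ∫ t, g t ∂(nevanlinnaMeasure S hS x) =
      ∫ t, (1 / (1 + t ^ 2) : ℝ) • g t ∂(formMeasure S hS x) := by
  rw [nevanlinnaMeasure, integral_withDensity_eq_integral_toReal_smul (by fun_prop)
    (ae_of_all _ fun _ => ENNReal.ofReal_lt_top)]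
  refine integral_congr_ae (ae_of_all _ fun t => ?_)
  dsimp only
  rw [ENNReal.toReal_ofReal (by positivity)]

theorem integrable_nevanlinnaMeasure_iff (hS : Monotone S) {F : Type*} [NormedAddCommGroup F]
    [NormedSpace ℝ F] (g : ℝ → F) (x : E) :
    Integrable g (nevanlinnaMeasure S hS x) ↔
      Integrable (fun t => (1 / (1 + t ^ 2) : ℝ) • g t) (formMeasure S hS x) := by
  rw [nevanlinnaMeasure, integrable_withDensity_iff_integrable_smul' (by fun_prop)
    (ae_of_all _ fun _ => ENNReal.ofReal_lt_top)]
  refine integrable_congr (ae_of_all _ fun t => ?_)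
  dsimp only
  rw [ENNReal.toReal_ofReal (by positivity)]

theorem IsFrameAt.integral_nevanlinnaMeasure (h : IsFrameAt u c x) (hS : Monotone S)
    {F : Type*} [NormedAddCommGroup F] [NormedSpace ℝ F] {g : ℝ → F}
    (hg : ∀ y, Integrable g (nevanlinnaMeasure S hS y)) :
    ∫ t, g t ∂(nevanlinnaMeasure S hS x) =
      ∑ i, c i • ∫ t, g t ∂(nevanlinnaMeasure S hS (u i)) := by
  simp only [FPlus.integral_nevanlinnaMeasure]
  exact h.integral_formMeasure hS fun y => (integrable_nevanlinnaMeasure_iff hS g y).1 (hg y)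

/-- A finite measure dominating all measures `(dS(t) x, x) / (1 + t²)`. -/
def frameMeasure (S : ℝ → E →L[ℂ] E) (hS : Monotone S) (u : ι → E) : Measure ℝ :=
  ∑ i, nevanlinnaMeasure S hS (u i)

/-- The density of `(dS(t) (u i), u i) / (1 + t²)`. -/
def frameDensity (S : ℝ → E →L[ℂ] E) (hS : Monotone S) (u : ι → E) (i : ι) (t : ℝ) : ℝ :=
  ((nevanlinnaMeasure S hS (u i)).rnDeriv (frameMeasure S hS u) t).toReal

theorem nevanlinnaMeasure_le_frameMeasure (hS : Monotone S) (i : ι) :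
    nevanlinnaMeasure S hS (u i) ≤ frameMeasure S hS u :=
  Finset.single_le_sum (f := fun i => nevanlinnaMeasure S hS (u i))
    (fun _ _ => Measure.zero_le _) (Finset.mem_univ i)

theorem isFiniteMeasure_frameMeasure (hS : Monotone S)
    (hfin : HasFiniteNevanlinnaIntegral S hS) : IsFiniteMeasure (frameMeasure S hS u) :=
  haveI := fun i => isFiniteMeasure_nevanlinnaMeasure hS hfin (u i)
  inferInstanceAs (IsFiniteMeasure (∑ i, nevanlinnaMeasure S hS (u i)))

theorem measurable_frameDensity (hS : Monotone S) (i : ι) :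
    Measurable (frameDensity S hS u i) :=
  (Measure.measurable_rnDeriv _ _).ennreal_toReal

theorem norm_frameDensity_le (hS : Monotone S) (hfin : HasFiniteNevanlinnaIntegral S hS) (i : ι) :
    ∀ᵐ t ∂(frameMeasure S hS u), ‖frameDensity S hS u i t‖ ≤ 1 := by
  have := isFiniteMeasure_frameMeasure (u := u) hS hfin
  filter_upwards [Measure.rnDeriv_le_one_of_le (nevanlinnaMeasure_le_frameMeasure (u := u) hS i)]
    with t ht
  rw [frameDensity, Real.norm_of_nonneg ENNReal.toReal_nonneg]
  exact ENNReal.toReal_le_of_le_ofReal zero_le_one (by simpa using ht)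

theorem integral_frameDensity_smul (hS : Monotone S) (hfin : HasFiniteNevanlinnaIntegral S hS)
    {F : Type*} [NormedAddCommGroup F] [NormedSpace ℝ F] (g : ℝ → F) (i : ι) :
    ∫ t, frameDensity S hS u i t • g t ∂(frameMeasure S hS u) =
      ∫ t, g t ∂(nevanlinnaMeasure S hS (u i)) := by
  have := isFiniteMeasure_frameMeasure (u := u) hS hfin
  have := isFiniteMeasure_nevanlinnaMeasure hS hfin (u i)
  exact integral_rnDeriv_smul (nevanlinnaMeasure_le_frameMeasure hS i).absolutelyContinuous

theorem IsFrameAt.integral_eq (h : IsFrameAt u c x) (hS : Monotone S)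
    (hfin : HasFiniteNevanlinnaIntegral S hS) {F : Type*} [NormedAddCommGroup F] [NormedSpace ℝ F]
    {g : ℝ → F} (hgm : StronglyMeasurable g) {C : ℝ} (hgb : ∀ t, ‖g t‖ ≤ C) :
    ∫ t, g t ∂(nevanlinnaMeasure S hS x) =
      ∫ t, (∑ i, c i * frameDensity S hS u i t) • g t ∂(frameMeasure S hS u) := by
  have := isFiniteMeasure_frameMeasure (u := u) hS hfin
  rw [h.integral_nevanlinnaMeasure hS fun y =>
    haveI := isFiniteMeasure_nevanlinnaMeasure hS hfin y
    Integrable.of_bound hgm.aestronglyMeasurable C (ae_of_all _ hgb)]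
  simp only [Finset.sum_smul, mul_smul]
  rw [integral_finsetSum]
  · simp only [integral_smul, integral_frameDensity_smul hS hfin]
  · intro i _
    refine Integrable.smul (c i) (Integrable.of_bound
      ((measurable_frameDensity hS i).aestronglyMeasurable.smul hgm.aestronglyMeasurable) C ?_)
    filter_upwards [norm_frameDensity_le (u := u) hS hfin i] with t ht
    rw [norm_smul]
    exact (mul_le_mul ht (hgb t) (norm_nonneg _) zero_le_one).trans_eq (one_mul C)

/-- The density at the frame vectors is an ordinary Radon-Nikodym derivative bounded by one, and `Ψ
= ∑ ρ_i C_i` transports it to every `x`. -/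
theorem exists_density [FiniteDimensional ℂ E] (hS : Monotone S)
    (hfin : HasFiniteNevanlinnaIntegral S hS) :
    ∃ (μ : Measure ℝ) (_ : IsFiniteMeasure μ) (Ψ : ℝ → E →L[ℂ] E), MemLp Ψ ∞ μ ∧
      (∀ᵐ t ∂μ, (Ψ t).IsPositive) ∧
      ∀ g : ℝ → ℂ, StronglyMeasurable g → ∀ C : ℝ, (∀ t, ‖g t‖ ≤ C) → ∀ x,
        ∫ t, (1 / (1 + t ^ 2) : ℝ) • g t ∂(formMeasure S hS x) =
          ∫ t, g t * inner ℂ x (Ψ t x) ∂μ := by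
  obtain ⟨n, u, C, hC, hu⟩ := exists_frame E
  have hframe : ∀ x, IsFrameAt u (fun i => (inner ℂ x (C i x)).re) x := fun x T hT => hu T hT x
  have hμ := isFiniteMeasure_frameMeasure (u := u) hS hfin
  set μ := frameMeasure S hS u
  set Ψ : ℝ → E →L[ℂ] E := fun t => ∑ i, (frameDensity S hS u i t : ℂ) • C i with hΨ
  have hΨC : ∀ t x, inner ℂ x (Ψ t x) =
      ((∑ i, (inner ℂ x (C i x)).re * frameDensity S hS u i t : ℝ) : ℂ) := fun t x => by
    simp only [hΨ, sum_apply, smul_apply, inner_sum, inner_smul_right, ofReal_sum, ofReal_mul]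
    refine Finset.sum_congr rfl fun i _ => ?_
    rw [inner_eq_ofReal_re (hC i), mul_comm]
    rfl
  have hΨm : StronglyMeasurable Ψ := by
    refine Finset.stronglyMeasurable_fun_sum _ fun i _ => ?_
    exact ((measurable_frameDensity hS i).complex_ofReal.stronglyMeasurable).smul_const (C i)
  have hΨs : ∀ t, (Ψ t : E →ₗ[ℂ] E).IsSymmetric := fun t x y => by
    simp only [hΨ, ContinuousLinearMap.coe_coe, sum_apply, smul_apply, inner_sum, sum_inner,
      inner_smul_right, inner_smul_left, conj_ofReal]
    exact Finset.sum_congr rfl fun i _ => congrArg _ (hC i x y)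
  have hr : ∀ᵐ t ∂μ, ∀ i, ‖frameDensity S hS u i t‖ ≤ 1 :=
    ae_all_iff.2 fun i => norm_frameDensity_le hS hfin i
  have hΨb : ∀ᵐ t ∂μ, ‖Ψ t‖ ≤ ∑ i, ‖C i‖ := by
    filter_upwards [hr] with t ht
    refine (norm_sum_le _ _).trans (Finset.sum_le_sum fun i _ => ?_)
    rw [norm_smul, norm_real]
    exact mul_le_of_le_one_left (norm_nonneg _) (ht i)
  refine ⟨μ, hμ, Ψ, memLp_top_of_bound hΨm.aestronglyMeasurable _ hΨb, ?_, ?_⟩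
  · have hpos : ∀ x, ∀ᵐ t ∂μ, 0 ≤ (inner ℂ x (Ψ t x)).re := fun x => by
      have hm : StronglyMeasurable fun t => (inner ℂ x (Ψ t x)).re :=
        (continuous_re.comp_stronglyMeasurable
          ((innerSL ℂ x).continuous.comp_stronglyMeasurable ((ContinuousLinearMap.apply ℂ E x).continuous.comp_stronglyMeasurable hΨm)))
      refine ae_nonneg_of_forall_setIntegral_nonneg (Integrable.of_bound hm.aestronglyMeasurable
        (‖x‖ * ((∑ i, ‖C i‖) * ‖x‖)) ?_) fun s hs _ => ?_
      · filter_upwards [hΨb] with t ht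
        refine (abs_re_le_norm _).trans ((norm_inner_le_norm _ _).trans ?_)
        gcongr
        exact (Ψ t).le_of_opNorm_le ht x
      · have := (hframe x).integral_eq hS hfin (g := s.indicator (fun _ => (1 : ℝ)))
          (stronglyMeasurable_const.indicator hs) (C := 1)
          fun t => by
            by_cases h : t ∈ s <;> simp [h]
        rw [← integral_indicator hs]
        refine le_of_le_of_eq ?_ (this.trans (integral_congr_ae (ae_of_all _ fun t => ?_)))
        · exact integral_nonneg fun t => Set.indicator_nonneg (fun _ _ => zero_le_one) t
        · dsimp only
          by_cases h : t ∈ s <;> simp [h, hΨC]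
    -- For each fixed `x` positivity holds outside a null set depending on `x`; a countable dense
    -- set and continuity give one null set for all `x`.
    obtain ⟨d, hdc, hd⟩ := TopologicalSpace.exists_countable_dense E
    have := hdc.to_subtype
    have hall : ∀ᵐ t ∂μ, ∀ x : d, 0 ≤ (inner ℂ (x : E) (Ψ t x)).re :=
      ae_all_iff.2 fun x => hpos x
    filter_upwards [hall] with t ht
    refine (ContinuousLinearMap.isPositive_def).2 ⟨hΨs t, fun x => ?_⟩
    rw [ContinuousLinearMap.reApplyInnerSelf_apply, inner_re_symm]
    have hcl : IsClosed {x : E | 0 ≤ RCLike.re (inner ℂ x (Ψ t x))} :=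
      isClosed_le continuous_const
        (RCLike.continuous_re.comp (continuous_id.inner (Ψ t).continuous))
    exact hcl.closure_subset_iff.2 (fun x hx => ht ⟨x, hx⟩) (hd x)
  · intro g hgm K hgb x
    rw [← FPlus.integral_nevanlinnaMeasure, (hframe x).integral_eq hS hfin hgm hgb]
    refine integral_congr_ae (ae_of_all _ fun t => ?_)
    dsimp only
    rw [hΨC, real_smul, mul_comm]

end Density

/-- Positive operators have square roots in their bicommutant. -/
theorem exists_sqrt {H : Type*} [NormedAddCommGroup H] [InnerProductSpace ℂ H] [CompleteSpace H]
    {A : H →L[ℂ] H} (hA : A.IsPositive) :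
    ∃ B : H →L[ℂ] H, B.IsPositive ∧ B * B = A ∧ ∀ T, Commute A T → Commute B T := by
  have hA' : 0 ≤ A := (ContinuousLinearMap.nonneg_iff_isPositive A).2 hA
  exact ⟨CFC.sqrt A, (ContinuousLinearMap.nonneg_iff_isPositive _).1 (CFC.sqrt_nonneg A),
    CFC.sqrt_mul_sqrt_self A hA', fun T hT => hT.cfcₙ_nnreal _⟩

/-! ### Square-root factorization of the density. -/

section Factorization

open scoped ENNReal

variable {E : Type*} [NormedAddCommGroup E] [InnerProductSpace ℂ E]

theorem isPositive_mulOp {α : Type*} [MeasurableSpace α] {μ : Measure α} {Ψ : α → E →L[ℂ] E}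
    (hΨ : MemLp Ψ ∞ μ) (hpos : ∀ᵐ t ∂μ, (Ψ t).IsPositive) : (mulOp Ψ hΨ).IsPositive := by
  refine ContinuousLinearMap.isPositive_def.2 ⟨fun f g => ?_, fun f => ?_⟩
  · simp only [ContinuousLinearMap.coe_coe, L2.inner_def]
    refine integral_congr_ae ?_
    filter_upwards [coeFn_mulOp Ψ hΨ f, coeFn_mulOp Ψ hΨ g, hpos] with t hf hg ht
    rw [hf, hg]
    exact ht.isSymmetric _ _
  · rw [ContinuousLinearMap.reApplyInnerSelf_apply, inner_re_symm, L2.inner_def,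
      ← integral_re (L2.integrable_inner _ _)]
    refine integral_nonneg_of_ae ?_
    filter_upwards [coeFn_mulOp Ψ hΨ f, hpos] with t hf ht
    rw [hf]
    exact ht.re_inner_nonneg_right _

theorem commute_mulOp_smulOp {α : Type*} [MeasurableSpace α] {μ : Measure α} {Ψ : α → E →L[ℂ] E}
    (hΨ : MemLp Ψ ∞ μ) {c : α → ℂ} (hc : MemLp c ∞ μ) :
    Commute (mulOp Ψ hΨ) (smulOp E c hc) := by
  refine ContinuousLinearMap.ext fun f => Lp.ext ?_
  rw [mul_apply_eq_comp, mul_apply_eq_comp]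
  filter_upwards [coeFn_mulOp Ψ hΨ (smulOp E c hc f), coeFn_smulOp c hc f,
    coeFn_smulOp c hc (mulOp Ψ hΨ f), coeFn_mulOp Ψ hΨ f] with t h₁ h₂ h₃ h₄
  rw [h₁, h₂, h₃, h₄, map_smul]

/-- A bounded positive operator function is the Gram function of a family of vectors in `L²`. -/
theorem exists_factorization [CompleteSpace E] {μ : Measure ℝ} [IsFiniteMeasure μ] {Ψ : ℝ → E →L[ℂ] E}
    (hΨ : MemLp Ψ ∞ μ) (hpos : ∀ᵐ t ∂μ, (Ψ t).IsPositive) :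
    ∃ Γ : E →L[ℂ] Lp E 2 μ, ∀ c (hc : MemLp c ∞ μ) x y,
      inner ℂ (Γ x) (smulOp E c hc (Γ y)) = ∫ t, c t * inner ℂ x (Ψ t y) ∂μ := by
  obtain ⟨B, hB, hBB, hcomm⟩ := exists_sqrt (isPositive_mulOp hΨ hpos)
  -- The square root is taken of the multiplication operator on `L²` rather than pointwise, so no
  -- measurable choice arises; it commutes with scalar multiplications because multiplication by `Ψ`
  -- does.
  refine ⟨B.comp (Lp.constL 2 μ ℂ), fun c hc x y => ?_⟩
  have h₁ : B (smulOp E c hc (B (Lp.constL 2 μ ℂ y))) =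
      smulOp E c hc (mulOp Ψ hΨ (Lp.constL 2 μ ℂ y)) := by
    have := DFunLike.congr_fun (hcomm _ (commute_mulOp_smulOp hΨ hc)).eq
      (B (Lp.constL 2 μ ℂ y))
    rw [mul_apply_eq_comp, mul_apply_eq_comp] at this
    rw [this, ← mul_apply_eq_comp B, hBB]
  refine ((hB.isSymmetric _ _).trans (congrArg (inner ℂ (Lp.constL 2 μ ℂ x)) h₁)).trans ?_
  rw [inner_smulOp_right]
  refine integral_congr_ae ?_
  filter_upwards [Lp.coeFn_const 2 μ x, Lp.coeFn_const 2 μ y,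
    coeFn_mulOp Ψ hΨ (Lp.constL 2 μ ℂ y)] with t hx hy h
  change _ * inner ℂ (Lp.const 2 μ x t) _ = _
  change _ = Ψ t (Lp.const 2 μ y t) at h
  rw [h, hx, hy]
  rfl

end Factorization

/-! ### Resolvents of multiplication by `t` and the operator form of `V`. -/

section Resolvent

open scoped ENNReal

variable {z : ℂ}

theorem ofReal_sub_ne_zero (hz : z.im ≠ 0) (t : ℝ) : (t : ℂ) - z ≠ 0 := fun h => hz <| by
  rw [← sub_eq_zero.1 h, ofReal_im]

theorem norm_inv_ofReal_sub_le (hz : z.im ≠ 0) (t : ℝ) : ‖((t : ℂ) - z)⁻¹‖ ≤ |z.im|⁻¹ := by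
  rw [norm_inv]
  refine inv_anti₀ (abs_pos.2 hz) ?_
  have := abs_im_le_norm ((t : ℂ) - z)
  rwa [sub_im, ofReal_im, zero_sub, abs_neg] at this

theorem continuous_div_ofReal_sub (hz : z.im ≠ 0) (a b : ℂ) :
    Continuous fun t : ℝ => (a + b * t) / ((t : ℂ) - z) :=
  (by fun_prop : Continuous fun t : ℝ => a + b * (t : ℂ)).div (by fun_prop) (ofReal_sub_ne_zero hz)

theorem norm_div_ofReal_sub_le (hz : z.im ≠ 0) (a b : ℂ) (t : ℝ) :
    ‖(a + b * t) / ((t : ℂ) - z)‖ ≤ ‖b‖ + ‖a + b * z‖ * |z.im|⁻¹ := by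
  have : (a + b * t) / ((t : ℂ) - z) = b + (a + b * z) * ((t : ℂ) - z)⁻¹ := by
    have := ofReal_sub_ne_zero hz t
    field_simp
    ring
  rw [this]
  refine (norm_add_le _ _).trans ?_
  rw [norm_mul]
  gcongr
  exact norm_inv_ofReal_sub_le hz t

theorem memLp_div_ofReal_sub (μ : Measure ℝ) (hz : z.im ≠ 0) (a b : ℂ) :
    MemLp (fun t : ℝ => (a + b * t) / ((t : ℂ) - z)) ∞ μ :=
  memLp_top_of_bound (continuous_div_ofReal_sub hz a b).aestronglyMeasurable _
    (ae_of_all _ (norm_div_ofReal_sub_le hz a b))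

variable (E : Type*) [NormedAddCommGroup E] [InnerProductSpace ℂ E] (μ : Measure ℝ)

/-- Multiplication by `(a + b t) / (t - z)`. -/
def moebiusOp (z : ℂ) (hz : z.im ≠ 0) (a b : ℂ) : Lp E 2 μ →L[ℂ] Lp E 2 μ :=
  smulOp E _ (memLp_div_ofReal_sub μ hz a b)

variable {E μ}

theorem coeFn_moebiusOp (hz : z.im ≠ 0) (a b : ℂ) (f : Lp E 2 μ) :
    moebiusOp E μ z hz a b f =ᵐ[μ] fun t : ℝ => ((a + b * t) / ((t : ℂ) - z)) • f t :=
  coeFn_smulOp _ _ f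

theorem I_im_ne_zero : I.im ≠ 0 := by simp

theorem moebiusOp_symm (x y : Lp E 2 μ) :
    inner ℂ (moebiusOp E μ I I_im_ne_zero 1 0 x) y -
      inner ℂ x (moebiusOp E μ I I_im_ne_zero 1 0 y) +
      2 * I * inner ℂ (moebiusOp E μ I I_im_ne_zero 1 0 x)
        (moebiusOp E μ I I_im_ne_zero 1 0 y) = 0 := by
  rw [← inner_smul_right, sub_add_eq_add_sub, ← inner_add_right, sub_eq_zero, L2.inner_def,
    L2.inner_def]
  refine integral_congr_ae ?_
  filter_upwards [coeFn_moebiusOp I_im_ne_zero 1 0 x, coeFn_moebiusOp I_im_ne_zero 1 0 y,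
    Lp.coeFn_add y ((2 * I) • moebiusOp E μ I I_im_ne_zero 1 0 y),
    Lp.coeFn_smul (2 * I) (moebiusOp E μ I I_im_ne_zero 1 0 y)] with t hx hy h₁ h₂
  rw [h₁, Pi.add_apply, h₂, Pi.smul_apply, hx, hy, smul_smul, inner_add_right, inner_smul_left,
    inner_smul_left, inner_smul_right, inner_smul_right]
  have h₃ := ofReal_sub_ne_zero I_im_ne_zero t
  have h₄ : (t : ℂ) + I ≠ 0 := by
    have := ofReal_sub_ne_zero (z := -I) (by simp) t
    rwa [sub_neg_eq_add] at this
  simp only [map_div₀, map_one, map_sub, conj_ofReal, conj_I,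
    sub_neg_eq_add, zero_mul, add_zero]
  field_simp
  ring

theorem eq_of_moebiusOp (hz : z.im ≠ 0) {p q : Lp E 2 μ}
    (h : p + (I - z) • moebiusOp E μ I I_im_ne_zero 1 0 p = q) :
    p = moebiusOp E μ z hz (-I) 1 q := by
  refine Lp.ext ?_
  subst h
  filter_upwards [coeFn_moebiusOp I_im_ne_zero 1 0 p,
    coeFn_moebiusOp hz (-I) 1 (p + (I - z) • moebiusOp E μ I I_im_ne_zero 1 0 p),
    Lp.coeFn_add p ((I - z) • moebiusOp E μ I I_im_ne_zero 1 0 p),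
    Lp.coeFn_smul (I - z) (moebiusOp E μ I I_im_ne_zero 1 0 p)] with t h₁ h₂ h₃ h₄
  rw [h₂, h₃, Pi.add_apply, h₄, Pi.smul_apply, h₁]
  have h₅ := ofReal_sub_ne_zero I_im_ne_zero t
  have h₆ := ofReal_sub_ne_zero hz t
  match_scalars
  field_simp
  ring

theorem moebiusOp_spec (hz : z.im ≠ 0) (q : Lp E 2 μ) :
    moebiusOp E μ z hz (-I) 1 q +
      (I - z) • moebiusOp E μ I I_im_ne_zero 1 0 (moebiusOp E μ z hz (-I) 1 q) = q := by
  refine Lp.ext ?_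
  set p := moebiusOp E μ z hz (-I) 1 q with hp
  filter_upwards [coeFn_moebiusOp I_im_ne_zero 1 0 p, coeFn_moebiusOp hz (-I) 1 q,
    Lp.coeFn_add p ((I - z) • moebiusOp E μ I I_im_ne_zero 1 0 p),
    Lp.coeFn_smul (I - z) (moebiusOp E μ I I_im_ne_zero 1 0 p)] with t h₁ h₂ h₃ h₄
  rw [h₃, Pi.add_apply, h₄, Pi.smul_apply, h₁, hp, h₂]
  have h₅ := ofReal_sub_ne_zero I_im_ne_zero t
  have h₆ := ofReal_sub_ne_zero hz t
  match_scalars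
  field_simp
  ring

theorem moebiusOp_injective {x : Lp E 2 μ} (h : moebiusOp E μ I I_im_ne_zero 1 0 x = 0) :
    x = 0 := by
  rw [Lp.eq_zero_iff_ae_eq_zero] at h ⊢
  filter_upwards [h, coeFn_moebiusOp I_im_ne_zero 1 0 x] with t h₁ h₂
  rw [h₂, Pi.zero_apply, smul_eq_zero, zero_mul, add_zero] at h₁
  exact h₁.resolve_left (one_div_ne_zero (ofReal_sub_ne_zero I_im_ne_zero t))

/-- Pointwise `p = (z - i)(t - i)/(t - z) g`, and `(z - i)(t + i)/(t - z) + i = (1 + zt)/(t - z)`,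
the kernel of `V`. -/
theorem moebiusOp_boundary (hz : z.im ≠ 0) {p g : Lp E 2 μ}
    (h : p + (I - z) • moebiusOp E μ I I_im_ne_zero 1 0 p = (z - I) • g) :
    p + (2 * I) • moebiusOp E μ I I_im_ne_zero 1 0 p + I • g = moebiusOp E μ z hz 1 z g := by
  have hp := eq_of_moebiusOp hz h
  rw [map_smul] at hp
  refine Lp.ext ?_
  filter_upwards [coeFn_moebiusOp I_im_ne_zero 1 0 p, coeFn_moebiusOp hz (-I) 1 g,
    coeFn_moebiusOp hz 1 z g,
    Lp.coeFn_add (p + (2 * I) • moebiusOp E μ I I_im_ne_zero 1 0 p) (I • g),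
    Lp.coeFn_add p ((2 * I) • moebiusOp E μ I I_im_ne_zero 1 0 p),
    Lp.coeFn_smul (2 * I) (moebiusOp E μ I I_im_ne_zero 1 0 p), Lp.coeFn_smul I g,
    Lp.coeFn_smul (z - I) (moebiusOp E μ z hz (-I) 1 g)] with t h₁ h₂ h₃ h₄ h₅ h₆ h₇ h₈
  have hpt : p t = (z - I) • ((-I + 1 * (t : ℂ)) / ((t : ℂ) - z)) • g t := by
    rw [hp, h₈, Pi.smul_apply, h₂]
  rw [h₄, Pi.add_apply, h₅, Pi.add_apply, h₆, h₇, Pi.smul_apply, Pi.smul_apply, h₁, h₃, hpt]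
  have h₉ := ofReal_sub_ne_zero I_im_ne_zero t
  have h₁₀ := ofReal_sub_ne_zero hz t
  match_scalars
  field_simp
  linear_combination (I - t) * I_sq

end Resolvent

/-- The kernel of the integral representation, with respect to the finite measure
`(dS(t) x, x) / (1 + t²)`. -/
theorem nevanlinnaKernel_eq {z : ℂ} (hz : z.im ≠ 0) (t : ℝ) :
    1 / ((t : ℂ) - z) - (t : ℂ) / (1 + (t : ℂ) ^ 2) =
      (1 / (1 + t ^ 2) : ℝ) • ((1 + z * t) / ((t : ℂ) - z)) := by
  have h₁ := ofReal_sub_ne_zero hz t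
  have h₂ : (1 : ℂ) + (t : ℂ) ^ 2 ≠ 0 := by
    exact_mod_cast (by positivity : (1 : ℝ) + t ^ 2 ≠ 0)
  rw [real_smul]
  push_cast
  field_simp
  ring

open ContinuousLinearMap (adjoint) in
/-- Operator form of the integral representation. -/
theorem exists_operator_representation {E : Type*} [NormedAddCommGroup E] [InnerProductSpace ℂ E]
    [FiniteDimensional ℂ E] [CompleteSpace E] {V : ℂ → E →L[ℂ] E} {Q : E →L[ℂ] E}
    {S : ℝ → E →L[ℂ] E} (hS : Monotone S) (hfin : HasFiniteNevanlinnaIntegral S hS)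
    (hrep : HasIntegralRepresentation V Q S hS) :
    ∃ (μ : Measure ℝ) (Γ : E →L[ℂ] Lp E 2 μ), ∀ (z : ℂ) (hz : z.im ≠ 0) (e : E),
      V z e = Q e + adjoint Γ (moebiusOp E μ z hz 1 z (Γ e)) := by
  obtain ⟨μ, _, Ψ, hΨ, hpos, hint⟩ := exists_density hS hfin
  obtain ⟨Γ, hΓ⟩ := exists_factorization hΨ hpos
  refine ⟨μ, Γ, fun z hz e => ?_⟩
  have key : V z = Q + (adjoint Γ).comp ((moebiusOp E μ z hz 1 z).comp Γ) := by
    refine ContinuousLinearMap.coe_injective ((ext_inner_map _ _).1 fun x => ?_)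
    rw [← inner_conj_symm, ← inner_conj_symm _ x]
    congr 1
    change inner ℂ x (V z x) = inner ℂ x (Q x + adjoint Γ (moebiusOp E μ z hz 1 z (Γ x)))
    rw [hrep z hz, inner_add_right, ContinuousLinearMap.adjoint_inner_right, moebiusOp, hΓ,
      ← hint _ (continuous_div_ofReal_sub hz 1 z).stronglyMeasurable _
        (norm_div_ofReal_sub_le hz 1 z)]
    simp only [nevanlinnaKernel_eq hz]
  rw [key]
  rfl

/-- The vectors representing the channel directions form a finite-dimensional space. -/
theorem finiteDimensional_comap_range {E 𝓗 : Type*} [AddCommGroup E] [Module ℂ E]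
    [FiniteDimensional ℂ E] [AddCommGroup 𝓗] [Module ℂ 𝓗] (R : 𝓗 →ₗ[ℂ] 𝓗) (Γ : E →ₗ[ℂ] 𝓗)
    (hR : ∀ x, R x = 0 → x = 0) : FiniteDimensional ℂ ((LinearMap.range Γ).comap R) := by
  refine Module.Finite.of_injective
    (R.restrict (p := (LinearMap.range Γ).comap R) (q := LinearMap.range Γ) fun _ hx => hx) ?_
  refine (injective_iff_map_eq_zero _).2 fun x hx => Subtype.ext (hR x ?_)
  exact congrArg Subtype.val hx

end FPlus

end

theorem theorem4p1 {E : Type u} [NormedAddCommGroup E] [InnerProductSpace ℂ E]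
    [FiniteDimensional ℂ E] (V : ℂ → E →L[ℂ] E) (hV : FPlus.IsHerglotzNevanlinna V)
    (Q : E →L[ℂ] E) (hQ : (Q : E →ₗ[ℂ] E).IsSymmetric)
    (S : ℝ → E →L[ℂ] E) (hS : Monotone S) (hfin : FPlus.HasFiniteNevanlinnaIntegral S hS)
    (hrep : FPlus.HasIntegralRepresentation V Q S hS) :
    ∃ (H : Type u) (_ : NormedAddCommGroup H) (_ : InnerProductSpace ℂ H) (_ : CompleteSpace H)
      (Θ : FPlus.FPlusSystem H E),
      Θ.IsScattering ∧
      (∀ z : ℂ, z.im < 0 → z ∈ Θ.resolventSet) ∧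
      ∀ z ∈ Θ.resolventSet, z.im ≠ 0 →
        IsUnit (Θ.transfer z + 1) ∧
        V z = Complex.I • (Ring.inverse (Θ.transfer z + 1) * (Θ.transfer z - 1)) := by
  have : CompleteSpace E := FiniteDimensional.complete ℂ E
  obtain ⟨μ, Γ, hΓ⟩ := FPlus.exists_operator_representation hS hfin hrep
  let R := FPlus.moebiusOp E μ I FPlus.I_im_ne_zero 1 0
  let X : Submodule ℂ (Lp E 2 μ) :=
    (LinearMap.range (Γ : E →ₗ[ℂ] Lp E 2 μ)).comap (R : Lp E 2 μ →ₗ[ℂ] Lp E 2 μ)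
  have hX : FiniteDimensional ℂ X := FPlus.finiteDimensional_comap_range
    (R : Lp E 2 μ →ₗ[ℂ] Lp E 2 μ) (Γ : E →ₗ[ℂ] Lp E 2 μ) fun _ => FPlus.moebiusOp_injective
  have : CompleteSpace X := FiniteDimensional.complete ℂ X
  obtain ⟨G, _, _, _, κ, b, hκ, hb, hbκ⟩ := FPlus.exists_transversal X
  obtain ⟨G', _, _, _, κ', b', hκ', hb', hbκ'⟩ := FPlus.exists_transversal E
  let M : FPlus.Model (Lp E 2 μ) E G G' X :=
    { R, Γ, Q, κ, b, κ', b'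
      Q_symm := hQ
      R_symm := FPlus.moebiusOp_symm
      R_surj := fun z hz q => ⟨_, FPlus.moebiusOp_spec hz q⟩
      mem_X := fun x => exists_congr fun e => eq_comm
      κ_isom := hκ
      b_symm := hb
      b_inj := hbκ
      κ'_isom := hκ'
      b'_symm := hb'
      b'_inj := hbκ' }
  refine ⟨M.State, inferInstance, inferInstance, inferInstance, M.boundarySystem.system, rfl,
    fun z hz => M.boundarySystem.mem_resolventSet hz, fun z hz hz' =>
      M.boundarySystem.transfer_spec (fun p hp => ?_) hz⟩
  -- This is the relation `Γ₁ = V(z) Γ₀` on the solutions of `L p = z F p`.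
  obtain ⟨h₁, h₂⟩ := M.Γ₁_eq_of_im_eq p.2 hp
  refine h₂.trans ?_
  rw [FPlus.moebiusOp_boundary hz' h₁, add_comm]
  exact (hΓ z hz' _).symm
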